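/- **Theorem 3 (Conditional asymptotic normality of Boulevard predictions).** Let $d\ge 1$, $0<\lambda<1$, $f:[0,1]^d\to\mathbb R$, and let $x_{n,1},\dots,x_{n,n}\in[0,1]^d$ ($n\ge 1$) be a fixed triangular array of covariates. For each $n$ let $y_{n,i}=f(x_{n,i})+\epsilon_{n,i}$, where $\epsilon_{n,1},\dots,\epsilon_{n,n}$ are i.i.d. with a law that does not depend on $n$ and is sub-Gaussian with mean $0$ and variance $\sigma_\epsilon^2$; write $Y_n=(y_{n,1},\dots,y_{n,n})^T$. *Trees.* A tree structure $q$ is a partition of $[0,1]^d$ into finitely many hyper-rectangles (leaves). For an index set $w\subseteq\{1,\dots,n\}$ and a point $z$ in the leaf $A$ of $q$, its structure vector $s_n(z)=s_n(z;q,w)\in\mathbb R^n$ has entries $s_{n,k}(z)=I(x_{n,k}\in A)I(k\in w)/\sum_i I(x_{n,i}\in A)I(i\in w)$, with $0/0=0$; $S_n$ is the matrix with rows $s_n(x_{n,1})^T,\dots,s_n(x_{n,n})^T$. For each $n$ random tree structures $q_1,q_2,\dots$ with values in a set $Q_n$ and random subsamples $w_1,w_2,\dots$ are given, where $w_b$ is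 uniform on the index sets of a fixed size $m_n$, $1\le m_n\le n$, and independent of $Y_n$, of the earlier trees and of $q_b$. Assume * non-adaptivity: the conditional law of $q_{b+1}$ given $Y_n$ and $(q_j,w_j)_{j\le b}$ is one and the same law $\mathcal Q_n$ (which may depend on $Y_n$) for all $b\ge 0$; * structure-value isolation: for all $b$, $i$ and $z$, the entry $s_{n,i}(z;q_b,w_b)$ is independent of the vector $Y_n$. *Boulevard.* Let $\hat f_{n,0}=0$ and, for $b\ge 1$, $$\hat f_{n,b}(z)=\tfrac{b-1}{b}\hat f_{n,b-1}(z)+\tfrac{\lambda}{b}\,s_n(z;q_b,w_b)^T\bigl(Y_n-\Gamma_M(\hat f_{n,b-1}(x_{n,1}),\dots,\hat f_{n,b-1}(x_{n,n}))\bigr),$$ where $\Gamma_M(t)=\mathrm{sign}(t)(|t|\wedge M)$ is applied entrywise and $M$ is large compared with the responses: $M\ge C\max_i|y_{n,i}|$ for a suitable constant $C$. Write $\hat f_n(z)=\lim_{b\to\infty}\hat f_{n,b}(z)$. *Rates.* Fix $x\in[0,1]^d$. Let $d_n>0$ be such that, for all large $n$, every leaf of every $q\in Q_n$ has diameter at most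 $d_n$, with $d_n=O(n^{-\frac1{d+2}-\varepsilon_1})$ for some $\varepsilon_1>0$ (for example $d_n=O(n^{-1/(d+1)})$). Assume * $|B_n|$ is of exact order $n\,d_n^d$, i.e. $|B_n|=\Omega(n d_n^d)$ and $|B_n|=O(n d_n^d)$, where $B_n=\{i:\ |x_{n,i}-x|\le d_n\}$; * $\inf_{A\in q\in Q_n}\sum_{i=1}^n I(x_{n,i}\in A)=\Omega\bigl(n^{\frac1{d+2}}\bigr)$. Let $k_n^T=\mathbb E[s_n(x)^T]$, $K_n=\mathbb E[S_n]$ (expectations over the random tree structure and subsample), $r_n^T=k_n^T\bigl[\tfrac1\lambda I+K_n\bigr]^{-1}$ and $f(X_n)=(f(x_{n,1}),\dots,f(x_{n,n}))^T$. Then there is a constant $C>0$ such that for every $n$, almost surely, the limit $\hat f_n(x)$ exists and is the same for all $M\ge C\max_i|y_{n,i}|$, and $$\frac{\hat f_n(x)-r_n^Tf(X_n)}{\lVert r_n\rVert}\ \xrightarrow{\ d\ }\ N(0,\sigma_\epsilon^2)\qquad(n\to\infty).$$ -/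

import Mathlib

open MeasureTheory ProbabilityTheory Filter Topology Asymptotics
open scoped NNReal Matrix

namespace Boulevard

noncomputable section

/-- The covariate space `[0,1]^d` inside Euclidean space. -/
def unitCube (d : ℕ) : Set (EuclideanSpace ℝ (Fin d)) :=
  {x | ∀ j, x j ∈ Set.Icc (0 : ℝ) 1}

/-- Hyper-rectangles: products of intervals (open, closed or half-open; the order-connected
subsets of `ℝ` are exactly the intervals). -/
def IsHyperrectangle {d : ℕ} (A : Set (EuclideanSpace ℝ (Fin d))) : Prop :=
  ∃ I : Fin d → Set ℝ, (∀ j, (I j).OrdConnected) ∧ A = {x | ∀ j, x j ∈ I j}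

/-- A tree structure: a partition of `[0,1]^d` into finitely many hyper-rectangles (leaves). -/
structure TreeStructure (d : ℕ) where
  leaves : Set (Set (EuclideanSpace ℝ (Fin d)))
  finite_leaves : leaves.Finite
  isHyperrectangle : ∀ A ∈ leaves, IsHyperrectangle A
  nonempty : ∀ A ∈ leaves, A.Nonempty
  pairwiseDisjoint : leaves.PairwiseDisjoint id
  sUnion_leaves : ⋃₀ leaves = unitCube d

/-- `u` and `v` lie in a common leaf of the tree structure `q`. -/
def TreeStructure.SameLeaf {d : ℕ} (q : TreeStructure d) (u v : EuclideanSpace ℝ (Fin d)) :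
    Prop :=
  ∃ A ∈ q.leaves, u ∈ A ∧ v ∈ A

/-- The σ-algebra on tree structures generated by the events "`u` and `v` share a leaf". A random
tree structure is only required to be measurable for this σ-algebra. -/
instance (d : ℕ) : MeasurableSpace (TreeStructure d) :=
  MeasurableSpace.generateFrom {E | ∃ u v, E = {q : TreeStructure d | q.SameLeaf u v}}

/-- The structure vector `s_n(x; w)` of the tree structure `q`, for the covariates `X` and the
subsample `w`; `0 / 0 = 0`. -/
def structVec {d n : ℕ} (X : Fin n → EuclideanSpace ℝ (Fin d)) (q : TreeStructure d)
    (w : Finset (Fin n)) (x : EuclideanSpace ℝ (Fin d)) (k : Fin n) : ℝ :=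
  open scoped Classical in
  (if q.SameLeaf x (X k) ∧ k ∈ w then (1 : ℝ) else 0) /
    ((w.filter fun i => q.SameLeaf x (X i)).card : ℝ)

/-- The truncation `Γ_M(t) = sign(t) (|t| ∧ M)`. -/
def trunc (M t : ℝ) : ℝ := Real.sign t * min |t| M

/-- The Boulevard iteration with learning rate `lam` and truncation level `M`, for covariates `X`
and responses `y`; the tree built in step `b + 1` has structure `q b` and subsample `w b`. -/
def boulevard {d n : ℕ} (lam M : ℝ) (X : Fin n → EuclideanSpace ℝ (Fin d)) (y : Fin n → ℝ)
    (q : ℕ → TreeStructure d) (w : ℕ → Finset (Fin n)) :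
    ℕ → EuclideanSpace ℝ (Fin d) → ℝ
  | 0, _ => 0
  | b + 1, x =>
      (((b + 1 : ℕ) : ℝ) - 1) / ((b + 1 : ℕ) : ℝ) * boulevard lam M X y q w b x +
        lam / ((b + 1 : ℕ) : ℝ) *
          ∑ i, structVec X (q b) (w b) x i * (y i - trunc M (boulevard lam M X y q w b (X i)))

/-- Number of sample points in `A`. -/
def leafCount {d n : ℕ} (X : Fin n → EuclideanSpace ℝ (Fin d))
    (A : Set (EuclideanSpace ℝ (Fin d))) : ℕ :=
  open scoped Classical in (Finset.univ.filter fun i => X i ∈ A).card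

/-- `|B_n|`: number of sample points at Euclidean distance at most `δ` from `x`. -/
def nbhdCount {d n : ℕ} (X : Fin n → EuclideanSpace ℝ (Fin d))
    (x : EuclideanSpace ℝ (Fin d)) (δ : ℝ) : ℕ :=
  open scoped Classical in (Finset.univ.filter fun i => dist (X i) x ≤ δ).card

section Ensemble

variable {Ω : Type*} {d n : ℕ}

/-- The information available after `b` trees have been built: the responses and the first `b`
tree structures and subsamples. -/
@[reducible]
def history (Y : Ω → Fin n → ℝ) (q : ℕ → Ω → TreeStructure d) (w : ℕ → Ω → Finset (Fin n))
    (b : ℕ) : MeasurableSpace Ω :=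
  MeasurableSpace.comap Y inferInstance ⊔
    ⨆ j : Fin b, (MeasurableSpace.comap (q j) inferInstance ⊔
      MeasurableSpace.comap (w j) inferInstance)

variable [MeasurableSpace Ω]

/-- In every step the subsample is drawn uniformly from the index sets of size `s`, independently
of everything that has been generated before (responses, previous trees and the current tree
structure). -/
structure UniformSubsampling (μ : Measure Ω) (Y : Ω → Fin n → ℝ) (q : ℕ → Ω → TreeStructure d)
    (w : ℕ → Ω → Finset (Fin n)) (s : ℕ) : Prop where
  measurable : ∀ b, Measurable (w b)
  uniform : ∀ b (v : Finset (Fin n)), v.card = s → μ.real (w b ⁻¹' {v}) = 1 / (n.choose s : ℝ)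
  indep : ∀ b, Indep (MeasurableSpace.comap (w b) inferInstance)
    (history Y q w b ⊔ MeasurableSpace.comap (q b) inferInstance) μ

/-- Non-adaptivity: the space `Q` of possible tree structures and the distribution of the next tree
structure, given the sample and after `b` trees have been built, are the same for all `b`. The
common distribution `κ` may depend on the responses. -/
structure NonAdaptive (μ : Measure Ω) (Y : Ω → Fin n → ℝ) (q : ℕ → Ω → TreeStructure d)
    (w : ℕ → Ω → Finset (Fin n)) (Q : Set (TreeStructure d)) : Prop where
  measurable : ∀ b, Measurable (q b)
  mem : ∀ b, ∀ᵐ ω ∂μ, q b ω ∈ Q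
  condLaw : ∃ κ : Kernel (Fin n → ℝ) (TreeStructure d), IsMarkovKernel κ ∧
    ∀ b (E : Set (TreeStructure d)), MeasurableSet E →
      μ⟦q b ⁻¹' E | history Y q w b⟧ =ᵐ[μ] fun ω => (κ (Y ω)).real E

/-- Structure-value isolation: every entry of every structure vector of every tree is independent
of the response vector. -/
def StructureValueIsolation (μ : Measure Ω) (X : Fin n → EuclideanSpace ℝ (Fin d))
    (Y : Ω → Fin n → ℝ) (q : ℕ → Ω → TreeStructure d) (w : ℕ → Ω → Finset (Fin n)) : Prop :=
  ∀ (b : ℕ) (x : EuclideanSpace ℝ (Fin d)) (i : Fin n),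
    IndepFun (fun ω => structVec X (q b ω) (w b ω) x i) Y μ

/-- `k_n = 𝔼[s_n(x)]` for a random tree structure `q` and a random subsample `w`. -/
def kVec (μ : Measure Ω) (X : Fin n → EuclideanSpace ℝ (Fin d)) (q : Ω → TreeStructure d)
    (w : Ω → Finset (Fin n)) (x : EuclideanSpace ℝ (Fin d)) : Fin n → ℝ :=
  fun i => ∫ ω, structVec X (q ω) (w ω) x i ∂μ

/-- `K_n = 𝔼[S_n]`, whose `j`-th row is `𝔼[s_n(x_j)]`. -/
def kMat (μ : Measure Ω) (X : Fin n → EuclideanSpace ℝ (Fin d)) (q : Ω → TreeStructure d)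
    (w : Ω → Finset (Fin n)) : Matrix (Fin n) (Fin n) ℝ :=
  Matrix.of fun j => kVec μ X q w (X j)

/-- `r_nᵀ = k_nᵀ [λ⁻¹ I + K_n]⁻¹`, as a vector of Euclidean space. -/
def rVec (lam : ℝ) (μ : Measure Ω) (X : Fin n → EuclideanSpace ℝ (Fin d))
    (q : Ω → TreeStructure d) (w : Ω → Finset (Fin n)) (x : EuclideanSpace ℝ (Fin d)) :
    EuclideanSpace ℝ (Fin n) :=
  WithLp.toLp 2 (kVec μ X q w x ᵥ* ((1 / lam) • (1 : Matrix (Fin n) (Fin n) ℝ) + kMat μ X q w)⁻¹)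

end Ensemble

end

end Boulevard

namespace Boulevard

noncomputable section

/-! ### A central limit theorem for weighted sums of i.i.d. variables -/

/-! The limit of the predictions is linear in the responses, `fhat = rᵀ Y`, so the centred
prediction is exactly `rᵀ ε`, a weighted sum of i.i.d. errors. It is asymptotically normal once the
largest weight is negligible against `‖r‖`.

Linearity. Given the past, the conditional probability that a structure entry lies in a fixed set is
the same function of `Y` in all steps; isolation forces this function to be almost surely constant.
For a fixed point and index, the entries along the ensemble are therefore identically distributed
and pairwise independent, and the strong law gives that their averages tend to `k`
(`ae_tendsto_average_structVec`). The rest is deterministic (`tendsto_boulevard`). The prediction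
after `b` trees is `lam` times an average of structure vectors paired with truncated residuals.
These residuals move by `O(1 / j)` per step, so summation by parts replaces the structure vectors by
their mean up to `o(1)`. At the sample points the distance to the fixed point `u + lam K u = y` is
then at most `lam < 1` times its own Cesàro mean plus `o(1)`, hence vanishes. For large `M` the
truncation is inactive at the fixed point, which leaves a linear limit independent of `M`.

Negligibility (`sq_rVec_le`). Uniform subsampling makes the sample points of a leaf exchangeable. So
`K` is symmetric with row and column sums at most one, and each `k_i` is at most `(∑ k) / N`, where
`N` bounds the leaf counts from below. The equation `r / lam + rᵀ K = k` yields a sup-norm bound of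
`r` by that of `k`, and an `ℓ²` bound of `k` by `r`. As `k` lives on the points of `B_n`,
Cauchy-Schwarz gives `(∑ k)² ≤ |B_n| ‖k‖²`. Together, `r_i² / ‖r‖²` is at most a constant times
`|B_n| / N²`, which is `O(n ^ (-d ε₁))`. -/

lemma norm_prod_sub_prod_le_sum {ι : Type*} (s : Finset ι) (f g : ι → ℂ)
    (hf : ∀ i, ‖f i‖ ≤ 1) (hg : ∀ i, ‖g i‖ ≤ 1) :
    ‖∏ i ∈ s, f i - ∏ i ∈ s, g i‖ ≤ ∑ i ∈ s, ‖f i - g i‖ := by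
  classical
  induction s using Finset.induction_on with
  | empty => simp
  | insert a s ha ih =>
    rw [Finset.prod_insert ha, Finset.prod_insert ha, Finset.sum_insert ha]
    have hg' : ‖∏ i ∈ s, g i‖ ≤ 1 := by
      rw [norm_prod]
      exact Finset.prod_le_one (fun _ _ => norm_nonneg _) fun i _ => hg i
    calc ‖f a * ∏ i ∈ s, f i - g a * ∏ i ∈ s, g i‖
        = ‖(f a - g a) * ∏ i ∈ s, g i + f a * (∏ i ∈ s, f i - ∏ i ∈ s, g i)‖ := by ring_nf
      _ ≤ ‖f a - g a‖ * ‖∏ i ∈ s, g i‖ + ‖f a‖ * ‖∏ i ∈ s, f i - ∏ i ∈ s, g i‖ := by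
          refine (norm_add_le _ _).trans ?_
          rw [norm_mul, norm_mul]
      _ ≤ ‖f a - g a‖ * 1 + 1 * ∑ i ∈ s, ‖f i - g i‖ := by
          gcongr
          exact hf a
      _ = _ := by ring

/-- Two laws with the same first two moments have characteristic functions that agree up to
`o(t ^ 2)` at the origin. -/
lemma charFun_sub_charFun_isLittleO {ν ρ : Measure ℝ} [IsProbabilityMeasure ν]
    [IsProbabilityMeasure ρ] (hν : MemLp id 2 ν) (hρ : MemLp id 2 ρ)
    (h1 : ∫ e, e ∂ν = ∫ e, e ∂ρ) (h2 : ∫ e, e ^ 2 ∂ν = ∫ e, e ^ 2 ∂ρ) :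
    (fun t => charFun ν t - charFun ρ t) =o[𝓝 0] fun t : ℝ => t ^ 2 := by
  have key : ∀ {κ : Measure ℝ} [IsProbabilityMeasure κ], MemLp id 2 κ →
      (fun t => charFun κ t - (1 + ((∫ e, e ∂κ : ℝ) : ℂ) * t * Complex.I -
        ((∫ e, e ^ 2 ∂κ : ℝ) : ℂ) * t ^ 2 / 2)) =o[𝓝 0] fun t : ℝ => t ^ 2 := by
    intro κ _ hκ
    -- A finite second moment makes the characteristic function twice differentiable, and its
    -- second-order Taylor polynomial at the origin involves only the first two moments.
    have h := taylor_isLittleO_univ (x₀ := (0 : ℝ)) (n := 2) (f := charFun κ)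
      (contDiff_charFun hκ)
    have h' : ∀ t, taylorWithinEval (charFun κ) 2 Set.univ 0 t = _ := fun t => by
      have := taylorWithinEval_charFun_two_zero (P := κ) (X := id) aemeasurable_id
        (by simpa using hκ) t
      simpa only [Measure.map_id] using this
    simp_rw [h'] at h
    simpa using h
  have := (key hν).sub (key hρ)
  refine this.congr_left fun t => ?_
  rw [h1, h2]
  ring

/-- Weighted sums of i.i.d. centred variables with unit-norm, uniformly negligible weights are
asymptotically normal. -/
theorem tendstoInDistribution_weightedSum {ν : Measure ℝ} [IsProbabilityMeasure ν] {σ : ℝ≥0}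
    (hν : MemLp id 2 ν) (hmean : ∫ e, e ∂ν = 0) (hvar : ∫ e, e ^ 2 ∂ν = (σ : ℝ) ^ 2)
    {Ω : ℕ → Type*} [∀ n, MeasurableSpace (Ω n)] (μ : (n : ℕ) → Measure (Ω n))
    [∀ n, IsProbabilityMeasure (μ n)]
    (ε : (n : ℕ) → Fin n → Ω n → ℝ) (hε_meas : ∀ n i, Measurable (ε n i))
    (hε_law : ∀ n i, (μ n).map (ε n i) = ν) (hε_indep : ∀ n, iIndepFun (ε n) (μ n))
    (a : (n : ℕ) → Fin n → ℝ) (ha : ∀ᶠ n in atTop, ∑ i, a n i ^ 2 = 1)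
    (hmax : ∀ η > 0, ∀ᶠ n in atTop, ∀ i, |a n i| ≤ η) :
    TendstoInDistribution (fun n ω => ∑ i, a n i * ε n i ω) atTop id μ
      (gaussianReal 0 (σ ^ 2)) where
  forall_aemeasurable n := by fun_prop
  tendsto := by
    refine ProbabilityMeasure.tendsto_iff_tendsto_charFun.2 fun t ↦ ?_
    simp only [ProbabilityMeasure.coe_mk, Measure.map_id]
    set γ := gaussianReal 0 (σ ^ 2) with hγ
    have hγ1 : ∫ e, e ∂γ = 0 := by simp [hγ]
    have hγ2 : ∫ e, e ^ 2 ∂γ = (σ : ℝ) ^ 2 := by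
      have h := variance_of_integral_eq_zero (μ := γ) (X := id) aemeasurable_id (by simpa using hγ1)
      rw [hγ, variance_id_gaussianReal, ← hγ] at h
      simpa using h.symm
    have hγL : MemLp id 2 γ := by
      rw [hγ]
      exact memLp_id_gaussianReal (μ := 0) (v := σ ^ (2 : ℕ)) 2
    have hlit := charFun_sub_charFun_isLittleO hν hγL (hmean.trans hγ1.symm) (hvar.trans hγ2.symm)
    have hprod : ∀ n, charFun ((μ n).map (fun ω => ∑ i, a n i * ε n i ω)) t =
        ∏ i, charFun ν (a n i * t) := fun n => by
      have hind : iIndepFun (fun i ω => a n i * ε n i ω) (μ n) :=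
        (hε_indep n).comp (fun i e => a n i * e) (fun i => by fun_prop)
      rw [hind.charFun_map_fun_sum_eq_prod (fun i => by fun_prop)]
      rw [Finset.prod_apply]
      refine Finset.prod_congr rfl fun i _ => ?_
      rw [charFun_map_mul_comp (hε_meas n i).aemeasurable, hε_law]
    -- The Gaussian law is stable under weights of unit norm, so both characteristic functions are
    -- products over the same arguments `a n i * t` and can be compared factor by factor.
    have hgauss : ∀ᶠ n in atTop, charFun γ t = ∏ i, charFun γ (a n i * t) := by
      filter_upwards [ha] with n hn
      simp only [hγ, charFun_gaussianReal, ← Complex.exp_sum]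
      congr 1
      have : ((∑ i, a n i ^ 2 : ℝ) : ℂ) = 1 := by rw [hn]; simp
      push_cast at this ⊢
      simp only [mul_zero, zero_mul, zero_sub, Finset.sum_neg_distrib, mul_pow]
      rw [← Finset.sum_div, ← Finset.mul_sum, ← Finset.sum_mul, this, one_mul]
    rw [Metric.tendsto_atTop']
    intro η hη
    -- The factor errors are at most this constant times `a n i ^ 2 * t ^ 2`; as the squared weights
    -- sum to one, the total stays below `η`. The `+ 1` covers `t = 0`.
    have hη' : 0 < η / (2 * (t ^ 2 + 1)) := by positivity
    have hev := hlit.def hη'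
    obtain ⟨τ, hτ, hball⟩ := Metric.eventually_nhds_iff.1 hev
    have hτ' : 0 < τ / (2 * (|t| + 1)) := by positivity
    obtain ⟨N, hN⟩ := eventually_atTop.1 ((hmax _ hτ').and (ha.and hgauss))
    refine ⟨N, fun n hn => ?_⟩
    obtain ⟨h1, h2, h3⟩ := hN n hn.le
    rw [hprod, h3, dist_eq_norm]
    refine (norm_prod_sub_prod_le_sum _ _ _ (fun i => norm_charFun_le_one _)
      (fun i => norm_charFun_le_one _)).trans_lt ?_
    have hb : ∀ i, ‖charFun ν (a n i * t) - charFun γ (a n i * t)‖ ≤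
        η / (2 * (t ^ 2 + 1)) * (a n i ^ 2 * t ^ 2) := fun i => by
      have := hball (y := a n i * t) (by
        rw [dist_zero_right, Real.norm_eq_abs, abs_mul]
        calc |a n i| * |t| ≤ τ / (2 * (|t| + 1)) * (|t| + 1) := by
              gcongr
              · exact h1 i
              · linarith
          _ = τ / 2 := by field_simp
          _ < τ := by linarith)
      simpa [mul_pow] using this
    calc _ ≤ ∑ i, η / (2 * (t ^ 2 + 1)) * (a n i ^ 2 * t ^ 2) := Finset.sum_le_sum fun i _ => hb i
      _ = η / (2 * (t ^ 2 + 1)) * t ^ 2 := by rw [← Finset.mul_sum, ← Finset.sum_mul, h2, one_mul]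
      _ < η := by
        rw [div_mul_eq_mul_div, div_lt_iff₀ (by positivity)]
        nlinarith [sq_nonneg t]

section

/-! ### Cesàro means -/

/-- If `D` has vanishing Cesàro means, so has `D * v` for every bounded weight `v` whose increments
are `O(1 / j)`. -/
lemma tendsto_cesaro_mul_of_slowly_varying {D v : ℕ → ℝ} {c : ℝ}
    (hD : Tendsto (fun b : ℕ => (∑ j ∈ Finset.range b, D j) / b) atTop (𝓝 0))
    (hv : ∀ j, |v j| ≤ c) (hv' : ∀ j : ℕ, |v (j + 1) - v j| ≤ c / ((j : ℝ) + 1)) :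
    Tendsto (fun b : ℕ => (∑ j ∈ Finset.range b, D j * v j) / b) atTop (𝓝 0) := by
  set T : ℕ → ℝ := fun b => ∑ j ∈ Finset.range b, D j with hT
  -- Summation by parts: the partial sums `T` are `o(j)` and meet only the increments of `v`, which
  -- are `O(1 / j)`. The products tend to zero, and so do their Cesàro means.
  have habel : ∀ b, ∑ j ∈ Finset.range b, D j * v j =
      T b * v b - ∑ j ∈ Finset.range b, T (j + 1) * (v (j + 1) - v j) := by
    intro b
    induction b with
    | zero => simp [hT]
    | succ b ih =>
      have hs : T (b + 1) = T b + D b := Finset.sum_range_succ _ _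
      rw [Finset.sum_range_succ, Finset.sum_range_succ, ih, hs]
      ring
  have h1 : Tendsto (fun b : ℕ => T b / b * v b) atTop (𝓝 0) :=
    hD.zero_mul_isBoundedUnder_le ⟨c, eventually_map.2 (Eventually.of_forall hv)⟩
  have h2 : Tendsto (fun j : ℕ => T (j + 1) * (v (j + 1) - v j)) atTop (𝓝 0) := by
    have h3 : Tendsto (fun j : ℕ => c * |T (j + 1) / ((j + 1 : ℕ) : ℝ)|) atTop (𝓝 0) := by
      have := ((tendsto_add_atTop_iff_nat 1).2 hD).abs.const_mul c
      simpa using this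
    refine squeeze_zero_norm (fun j => ?_) h3
    rw [Real.norm_eq_abs, abs_mul, abs_div, Nat.abs_cast]
    calc |T (j + 1)| * |v (j + 1) - v j| ≤ |T (j + 1)| * (c / ((j : ℝ) + 1)) := by
          gcongr
          exact hv' j
      _ = _ := by push_cast; ring
  have h4 := h1.sub h2.cesaro
  rw [sub_zero] at h4
  refine h4.congr fun b => ?_
  rw [habel]
  ring

/-- A bounded nonnegative sequence that is, up to a vanishing error, at most `lam < 1` times its
Cesàro means tends to zero. -/
lemma tendsto_zero_of_le_cesaro {u e : ℕ → ℝ} {lam c : ℝ} (hlam0 : 0 ≤ lam) (hlam1 : lam < 1)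
    (hu0 : ∀ b, 0 ≤ u b) (huc : ∀ b, u b ≤ c) (he : Tendsto e atTop (𝓝 0))
    (hu : ∀ b : ℕ, 1 ≤ b → u b ≤ lam * ((b : ℝ)⁻¹ * ∑ j ∈ Finset.range b, u j) + e b) :
    Tendsto u atTop (𝓝 0) := by
  -- The tail suprema decrease to `L = limsup u`.
  set g : ℕ → ℝ := fun b => ⨆ j, u (b + j) with hg
  have hbdd : ∀ b, BddAbove (Set.range fun j => u (b + j)) := fun b =>
    ⟨c, by rintro _ ⟨j, rfl⟩; exact huc _⟩
  have hug : ∀ b, u b ≤ g b := fun b => by simpa using le_ciSup (hbdd b) 0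
  have hanti : Antitone g := fun a b hab => ciSup_le fun j => by
    have := le_ciSup (hbdd a) (b - a + j)
    rwa [← add_assoc, Nat.add_sub_cancel' hab] at this
  have hg0 : ∀ b, 0 ≤ g b := fun b => (hu0 b).trans (hug b)
  obtain ⟨L, hL⟩ : ∃ L, Tendsto g atTop (𝓝 L) :=
    ⟨_, tendsto_atTop_ciInf hanti ⟨0, by rintro _ ⟨b, rfl⟩; exact hg0 b⟩⟩
  have hLg : ∀ b, L ≤ g b := fun b => hanti.le_of_tendsto hL b
  have hL0 : 0 ≤ L := ge_of_tendsto' hL hg0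
  have hlim : Tendsto (fun b : ℕ => lam * ((b : ℝ)⁻¹ * ∑ j ∈ Finset.range b, g j) + e b) atTop
      (𝓝 (lam * L)) := by
    simpa using (hL.cesaro.const_mul lam).add he
  -- If `L > 0`, then `u` is eventually below the midpoint of `lam * L` and `L`, hence so is some `g
  -- N`, contradicting `L ≤ g N`.
  have hLz : L = 0 := by
    by_contra hne
    have hpos : 0 < L := lt_of_le_of_ne hL0 (Ne.symm hne)
    have hlt : lam * L < (lam * L + L) / 2 := by nlinarith
    obtain ⟨N, hN⟩ := eventually_atTop.1 ((hlim.eventually_lt_const hlt).and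
      (eventually_ge_atTop 1))
    have : g N ≤ (lam * L + L) / 2 := ciSup_le fun j => by
      obtain ⟨h1, h2⟩ := hN (N + j) (by omega)
      refine (hu _ h2).trans (le_trans ?_ h1.le)
      gcongr
      exact hug _
    have := hLg N
    nlinarith
  rw [hLz] at hL
  exact squeeze_zero hu0 hug hL

/-! ### Truncation and structure vectors -/

/-- Clamping to `[-M, M]`: in this form the Lipschitz bound follows from those of `min` and `max`.
-/
lemma trunc_eq_max_min {M : ℝ} (hM : 0 ≤ M) (t : ℝ) : trunc M t = max (-M) (min t M) := by
  unfold trunc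
  rcases lt_trichotomy t 0 with h | rfl | h
  · rw [Real.sign_of_neg h, abs_of_neg h, min_eq_left (h.le.trans hM), neg_one_mul]
    rcases le_total (-t) M with h' | h'
    · rw [min_eq_left h', max_eq_right (by linarith), neg_neg]
    · rw [min_eq_right h', max_eq_left (by linarith)]
  · simp [hM]
  · rw [Real.sign_of_pos h, abs_of_pos h, one_mul, max_eq_right]
    exact (neg_nonpos.2 hM).trans (le_min h.le hM)

lemma abs_trunc_sub_trunc_le {M : ℝ} (hM : 0 ≤ M) (s t : ℝ) :
    |trunc M s - trunc M t| ≤ |s - t| := by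
  rw [trunc_eq_max_min hM, trunc_eq_max_min hM]
  refine (abs_max_sub_max_le_max _ _ _ _).trans ?_
  rw [sub_self, abs_zero, max_eq_right (abs_nonneg _)]
  refine (abs_min_sub_min_le_max _ _ _ _).trans ?_
  rw [sub_self, abs_zero, max_eq_left (abs_nonneg _)]

lemma abs_trunc_le {M : ℝ} (hM : 0 ≤ M) (t : ℝ) : |trunc M t| ≤ M := by
  rw [trunc_eq_max_min hM, abs_le]
  exact ⟨le_max_left _ _, max_le (by linarith) (min_le_right _ _)⟩

lemma trunc_of_abs_le {M t : ℝ} (h : |t| ≤ M) : trunc M t = t := by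
  rw [trunc_eq_max_min ((abs_nonneg t).trans h), min_eq_left (abs_le.1 h).2,
    max_eq_right (abs_le.1 h).1]

variable {d n : ℕ}

lemma structVec_nonneg (X : Fin n → EuclideanSpace ℝ (Fin d)) (q : TreeStructure d)
    (w : Finset (Fin n)) (x : EuclideanSpace ℝ (Fin d)) (k : Fin n) :
    0 ≤ structVec X q w x k := by
  unfold structVec
  positivity

lemma sum_structVec_le_one (X : Fin n → EuclideanSpace ℝ (Fin d)) (q : TreeStructure d)
    (w : Finset (Fin n)) (x : EuclideanSpace ℝ (Fin d)) :
    ∑ k, structVec X q w x k ≤ 1 := by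
  classical
  unfold structVec
  rw [← Finset.sum_div, Finset.sum_boole]
  refine div_le_one_of_le₀ ?_ (Nat.cast_nonneg _)
  refine le_of_eq ?_
  congr 2
  ext i
  simp [and_comm]

lemma structVec_le_one (X : Fin n → EuclideanSpace ℝ (Fin d)) (q : TreeStructure d)
    (w : Finset (Fin n)) (x : EuclideanSpace ℝ (Fin d)) (k : Fin n) :
    structVec X q w x k ≤ 1 :=
  (Finset.single_le_sum (fun i _ => structVec_nonneg X q w x i) (Finset.mem_univ k)).trans
    (sum_structVec_le_one X q w x)

/-! ### Pathwise convergence of the Boulevard iteration -/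

section Pathwise

variable {lam M : ℝ} {X : Fin n → EuclideanSpace ℝ (Fin d)} {y : Fin n → ℝ}
  {q : ℕ → TreeStructure d} {w : ℕ → Finset (Fin n)}

/-- Multiplication by `b` clears the weights `(b - 1) / b`, and the recursion telescopes. -/
lemma boulevard_eq_sum (b : ℕ) (z : EuclideanSpace ℝ (Fin d)) :
    (b : ℝ) * boulevard lam M X y q w b z = lam * ∑ j ∈ Finset.range b,
      ∑ i, structVec X (q j) (w j) z i * (y i - trunc M (boulevard lam M X y q w j (X i))) := by
  induction b with
  | zero => simp
  | succ b ih =>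
    rw [Finset.sum_range_succ, mul_add, ← ih, boulevard]
    have : ((b + 1 : ℕ) : ℝ) ≠ 0 := by positivity
    field_simp
    push_cast
    ring

lemma abs_sum_structVec_mul_le (q : TreeStructure d) (w : Finset (Fin n))
    (z : EuclideanSpace ℝ (Fin d)) {v : Fin n → ℝ} {G : ℝ} (hG : 0 ≤ G) (hv : ∀ i, |v i| ≤ G) :
    |∑ i, structVec X q w z i * v i| ≤ G := by
  calc |∑ i, structVec X q w z i * v i| ≤ ∑ i, |structVec X q w z i * v i| :=
        Finset.abs_sum_le_sum_abs _ _
    _ ≤ ∑ i, structVec X q w z i * G := by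
        refine Finset.sum_le_sum fun i _ => ?_
        rw [abs_mul, abs_of_nonneg (structVec_nonneg ..)]
        exact mul_le_mul_of_nonneg_left (hv i) (structVec_nonneg ..)
    _ ≤ 1 * G := by
        rw [← Finset.sum_mul]
        exact mul_le_mul_of_nonneg_right (sum_structVec_le_one ..) hG
    _ = G := one_mul G

lemma abs_sub_trunc_le (hM : 0 ≤ M) (b : ℕ) (i : Fin n) :
    |y i - trunc M (boulevard lam M X y q w b (X i))| ≤ ‖y‖ + M :=
  (abs_sub _ _).trans (add_le_add (norm_le_pi_norm y i) (abs_trunc_le hM _))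

/-- The prediction is `lam` times an average of `b` tree values. Truncation bounds each of them by
`‖y‖ + M`, whatever the earlier predictions are. -/
lemma abs_boulevard_le (hlam0 : 0 ≤ lam) (hlam1 : lam ≤ 1) (hM : 0 ≤ M) (b : ℕ)
    (z : EuclideanSpace ℝ (Fin d)) : |boulevard lam M X y q w b z| ≤ ‖y‖ + M := by
  have hG : 0 ≤ ‖y‖ + M := by positivity
  rcases Nat.eq_zero_or_pos b with rfl | hb
  · simpa [boulevard] using hG
  have hb' : (0 : ℝ) < b := by exact_mod_cast hb
  refine le_of_mul_le_mul_left ?_ hb'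
  rw [← abs_of_pos hb', ← abs_mul, abs_of_pos hb', boulevard_eq_sum, abs_mul, abs_of_nonneg hlam0]
  calc _ ≤ 1 * ∑ j ∈ Finset.range b, (‖y‖ + M) := by
        gcongr
        refine (Finset.abs_sum_le_sum_abs _ _).trans (Finset.sum_le_sum fun j _ => ?_)
        exact abs_sum_structVec_mul_le _ _ _ hG fun i => abs_sub_trunc_le hM j i
    _ = _ := by rw [Finset.sum_const, Finset.card_range, nsmul_eq_mul, one_mul]

/-- The increment is the new tree value minus the old prediction, both at most `‖y‖ + M`, scaled by
`1 / (b + 1)`. This is the slow variation that summation by parts needs. -/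
lemma abs_boulevard_succ_sub_le (hlam0 : 0 ≤ lam) (hlam1 : lam ≤ 1) (hM : 0 ≤ M) (b : ℕ)
    (z : EuclideanSpace ℝ (Fin d)) :
    |boulevard lam M X y q w (b + 1) z - boulevard lam M X y q w b z| ≤
      2 * (‖y‖ + M) / ((b : ℝ) + 1) := by
  have hG : 0 ≤ ‖y‖ + M := by positivity
  have hb : (0 : ℝ) < (b : ℝ) + 1 := by positivity
  have heq : boulevard lam M X y q w (b + 1) z - boulevard lam M X y q w b z =
      (lam * ∑ i, structVec X (q b) (w b) z i *
        (y i - trunc M (boulevard lam M X y q w b (X i))) - boulevard lam M X y q w b z) /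
          ((b : ℝ) + 1) := by
    rw [boulevard]
    push_cast
    field_simp
    ring
  rw [heq, abs_div, abs_of_pos hb]
  gcongr
  refine (abs_sub _ _).trans ?_
  have h1 := abs_boulevard_le (X := X) (y := y) (q := q) (w := w) hlam0 hlam1 hM b z
  have h2 := abs_sum_structVec_mul_le (X := X) (q b) (w b) z hG
    fun i => abs_sub_trunc_le (lam := lam) (X := X) (y := y) (q := q) (w := w) hM b i
  rw [abs_mul, abs_of_nonneg hlam0]
  nlinarith [abs_nonneg (∑ i, structVec X (q b) (w b) z i *
        (y i - trunc M (boulevard lam M X y q w b (X i))))]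

/-- The Boulevard prediction differs from the prediction with averaged structure vectors by a
vanishing term. -/
lemma tendsto_boulevard_sub_average (hlam0 : 0 ≤ lam) (hlam1 : lam ≤ 1) (hM : 0 ≤ M)
    {z : EuclideanSpace ℝ (Fin d)} {k : Fin n → ℝ}
    (hk : ∀ i, Tendsto (fun b : ℕ => (∑ j ∈ Finset.range b, structVec X (q j) (w j) z i) / b)
      atTop (𝓝 (k i))) :
    Tendsto (fun b : ℕ => boulevard lam M X y q w b z - lam * ∑ i, k i * ((b : ℝ)⁻¹ *
      ∑ j ∈ Finset.range b, (y i - trunc M (boulevard lam M X y q w j (X i))))) atTop (𝓝 0) := by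
  have hterm : ∀ i, Tendsto (fun b : ℕ => (∑ j ∈ Finset.range b,
      (structVec X (q j) (w j) z i - k i) *
        (y i - trunc M (boulevard lam M X y q w j (X i)))) / b) atTop (𝓝 0) := by
    intro i
    -- The weights are the truncated residuals. They inherit the increment bound of the predictions,
    -- since truncation is 1-Lipschitz; the constant serves for both the size and the increments.
    refine tendsto_cesaro_mul_of_slowly_varying (c := 2 * (‖y‖ + M)) ?_ (fun j => ?_) fun j => ?_
    · have := (hk i).sub_const (k i)
      rw [sub_self] at this
      refine this.congr' ?_
      filter_upwards [eventually_ge_atTop 1] with b hb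
      have hb' : (b : ℝ) ≠ 0 := by positivity
      rw [Finset.sum_sub_distrib, sub_div]
      simp [hb']
    · have := abs_sub_trunc_le (lam := lam) (X := X) (y := y) (q := q) (w := w) hM j i
      linarith [abs_nonneg (y i - trunc M (boulevard lam M X y q w j (X i)))]
    · rw [sub_sub_sub_cancel_left, abs_sub_comm]
      exact (abs_trunc_sub_trunc_le hM _ _).trans (abs_boulevard_succ_sub_le hlam0 hlam1 hM j _)
  have hsum := (tendsto_finsetSum Finset.univ fun i _ => hterm i).const_mul lam
  simp only [Finset.sum_const_zero, mul_zero] at hsum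
  refine hsum.congr' ?_
  filter_upwards [eventually_ge_atTop 1] with b hb
  have hb' : (b : ℝ) ≠ 0 := by positivity
  have h := boulevard_eq_sum (lam := lam) (M := M) (X := X) (y := y) (q := q) (w := w) b z
  rw [Finset.sum_comm] at h
  have h' : boulevard lam M X y q w b z = lam * ∑ i, (b : ℝ)⁻¹ * ∑ j ∈ Finset.range b,
      structVec X (q j) (w j) z i * (y i - trunc M (boulevard lam M X y q w j (X i))) := by
    rw [← Finset.mul_sum, mul_left_comm, ← h]
    field_simp
  conv_rhs => rw [h']
  rw [← mul_sub, ← Finset.sum_sub_distrib]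
  congr 1
  refine Finset.sum_congr rfl fun i _ => ?_
  simp only [sub_mul, Finset.sum_sub_distrib, ← Finset.mul_sum]
  ring

/-- If the averages of the structure vectors converge to `k`, the Boulevard predictions converge to
the fixed point of the averaged iteration. -/
theorem tendsto_boulevard (hlam0 : 0 ≤ lam) (hlam1 : lam < 1) (hM : 0 ≤ M)
    {x : EuclideanSpace ℝ (Fin d)} {k : EuclideanSpace ℝ (Fin d) → Fin n → ℝ}
    (hk0 : ∀ z i, 0 ≤ k z i) (hk1 : ∀ z, ∑ i, k z i ≤ 1)
    (hkx : ∀ i, Tendsto (fun b : ℕ => (∑ j ∈ Finset.range b, structVec X (q j) (w j) x i) / b)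
      atTop (𝓝 (k x i)))
    (hkX : ∀ l i, Tendsto (fun b : ℕ =>
      (∑ j ∈ Finset.range b, structVec X (q j) (w j) (X l) i) / b) atTop (𝓝 (k (X l) i)))
    {u : Fin n → ℝ} (hu : ∀ l, u l + lam * ∑ i, k (X l) i * u i = y l)
    (huM : ∀ l, |y l - u l| ≤ M) :
    Tendsto (fun b => boulevard lam M X y q w b x) atTop (𝓝 (lam * ∑ i, k x i * u i)) := by
  set F : ℕ → EuclideanSpace ℝ (Fin d) → ℝ := boulevard lam M X y q w with hF
  -- Here `u` is the residual at the fixed point, so `y l - u l` is the limiting prediction at the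
  -- `l`-th sample point.
  set err : ℕ → Fin n → ℝ := fun b l => F b (X l) - (y l - u l) with herr
  set rem : ℕ → Fin n → ℝ := fun b l => F b (X l) - lam * ∑ i, k (X l) i * ((b : ℝ)⁻¹ *
      ∑ j ∈ Finset.range b, (y i - trunc M (F j (X i)))) with hrem
  have hrem0 : Tendsto (fun b => ‖rem b‖) atTop (𝓝 0) := by
    have : Tendsto rem atTop (𝓝 0) := tendsto_pi_nhds.2 fun l =>
      tendsto_boulevard_sub_average hlam0 hlam1.le hM (hkX l)
    simpa using this.norm
  -- By `huM` truncation does not act on `y - u`, so the error of the residual is at most the error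
  -- of the prediction.
  have hv : ∀ j i, |(y i - trunc M (F j (X i))) - u i| ≤ ‖err j‖ := fun j i => by
    have h1 : (y i - trunc M (F j (X i))) - u i =
        trunc M (y i - u i) - trunc M (F j (X i)) := by
      rw [trunc_of_abs_le (huM i)]; ring
    rw [h1, abs_sub_comm]
    exact (abs_trunc_sub_trunc_le hM _ _).trans (norm_le_pi_norm (err j) i)
  have herr0 : Tendsto (fun b => ‖err b‖) atTop (𝓝 0) := by
    refine tendsto_zero_of_le_cesaro (c := ‖y‖ + M + M) hlam0 hlam1 (fun b => norm_nonneg _)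
      (fun b => ?_) hrem0 fun b hb => ?_
    · refine (pi_norm_le_iff_of_nonneg (by positivity)).2 fun l => ?_
      exact (abs_sub _ _).trans (add_le_add (abs_boulevard_le hlam0 hlam1.le hM b _) (huM l))
    · have hb' : (b : ℝ) ≠ 0 := by positivity
      have hS : 0 ≤ (b : ℝ)⁻¹ * ∑ j ∈ Finset.range b, ‖err j‖ := by positivity
      refine (pi_norm_le_iff_of_nonneg (by positivity)).2 fun l => ?_
      have hdec : err b l = lam * ∑ i, k (X l) i * ((b : ℝ)⁻¹ *
          ∑ j ∈ Finset.range b, ((y i - trunc M (F j (X i))) - u i)) + rem b l := by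
        have h1 : ∀ i, (b : ℝ)⁻¹ * ∑ j ∈ Finset.range b, ((y i - trunc M (F j (X i))) - u i) =
            (b : ℝ)⁻¹ * ∑ j ∈ Finset.range b, (y i - trunc M (F j (X i))) - u i := fun i => by
          rw [Finset.sum_sub_distrib, mul_sub]
          simp [hb']
        have h2 := hu l
        simp only [h1, herr, hrem]
        simp only [mul_sub (k _ _), Finset.sum_sub_distrib (s := Finset.univ)]
        linarith
      rw [hdec]
      refine (norm_add_le _ _).trans (add_le_add ?_ (norm_le_pi_norm (rem b) l))
      rw [norm_mul, Real.norm_of_nonneg hlam0]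
      gcongr
      calc ‖∑ i, k (X l) i * ((b : ℝ)⁻¹ *
              ∑ j ∈ Finset.range b, ((y i - trunc M (F j (X i))) - u i))‖
          ≤ ∑ i, k (X l) i * ((b : ℝ)⁻¹ * ∑ j ∈ Finset.range b, ‖err j‖) := by
            refine (norm_sum_le _ _).trans (Finset.sum_le_sum fun i _ => ?_)
            rw [norm_mul, norm_mul, Real.norm_of_nonneg (hk0 _ _),
              Real.norm_of_nonneg (by positivity : (0 : ℝ) ≤ (b : ℝ)⁻¹)]
            gcongr
            · exact hk0 _ _
            · exact (norm_sum_le _ _).trans (Finset.sum_le_sum fun j _ => hv j i)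
        _ ≤ 1 * ((b : ℝ)⁻¹ * ∑ j ∈ Finset.range b, ‖err j‖) := by
            rw [← Finset.sum_mul]
            exact mul_le_mul_of_nonneg_right (hk1 _) hS
        _ = _ := one_mul _
  -- Convergence at the sample points makes the residuals converge, and with them the averages that
  -- determine the prediction at `x`.
  have hvlim : ∀ i, Tendsto (fun j => y i - trunc M (F j (X i))) atTop (𝓝 (u i)) := fun i =>
    tendsto_iff_norm_sub_tendsto_zero.2 (squeeze_zero (fun _ => norm_nonneg _) (fun j => hv j i)
      herr0)
  have hmain := (tendsto_boulevard_sub_average (y := y) hlam0 hlam1.le hM hkx).add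
    ((tendsto_finsetSum Finset.univ fun i _ => (hvlim i).cesaro.const_mul (k x i)).const_mul lam)
  rw [zero_add] at hmain
  refine hmain.congr fun b => ?_
  rw [sub_add_cancel]

end Pathwise

end

section

/-! ### Structure vectors along the ensemble are i.i.d. -/

lemma measurableSet_sameLeaf {d : ℕ} (u v : EuclideanSpace ℝ (Fin d)) :
    MeasurableSet {q : TreeStructure d | q.SameLeaf u v} :=
  MeasurableSpace.measurableSet_generateFrom ⟨u, v, rfl⟩

lemma measurable_structVec {d n : ℕ} (X : Fin n → EuclideanSpace ℝ (Fin d))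
    (v : Finset (Fin n)) (z : EuclideanSpace ℝ (Fin d)) (i : Fin n) :
    Measurable fun q : TreeStructure d => structVec X q v z i := by
  classical
  unfold structVec
  refine Measurable.div (Measurable.ite ?_ measurable_const measurable_const) ?_
  · exact (measurableSet_sameLeaf z (X i)).inter (MeasurableSet.const _)
  · simp only [Finset.card_filter, Nat.cast_sum]
    refine Finset.measurable_sum _ fun j _ => ?_
    simp only [Nat.cast_ite]
    exact Measurable.ite (measurableSet_sameLeaf z (X j)) measurable_const measurable_const

lemma measurable_structVec_prod {d n : ℕ} (X : Fin n → EuclideanSpace ℝ (Fin d))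
    (z : EuclideanSpace ℝ (Fin d)) (i : Fin n) :
    Measurable fun p : TreeStructure d × Finset (Fin n) => structVec X p.1 p.2 z i :=
  measurable_from_prod_countable_left fun v => measurable_structVec X v z i

variable {Ω : Type*} {d n : ℕ}

lemma measurable_structVec_history {Y : Ω → Fin n → ℝ} {q : ℕ → Ω → TreeStructure d}
    {w : ℕ → Ω → Finset (Fin n)} (X : Fin n → EuclideanSpace ℝ (Fin d))
    (z : EuclideanSpace ℝ (Fin d)) (i : Fin n) {j b : ℕ} (hjb : j < b) :
    Measurable[history Y q w b] fun ω => structVec X (q j ω) (w j ω) z i := by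
  have hle : MeasurableSpace.comap (q j) inferInstance ⊔
      MeasurableSpace.comap (w j) inferInstance ≤ history Y q w b :=
    (le_iSup (fun j : Fin b => MeasurableSpace.comap (q j) inferInstance ⊔
      MeasurableSpace.comap (w j) inferInstance) ⟨j, hjb⟩).trans le_sup_right
  have hq : Measurable[history Y q w b] (q j) :=
    Measurable.mono (comap_measurable _) (le_sup_left.trans hle) le_rfl
  have hw : Measurable[history Y q w b] (w j) :=
    Measurable.mono (comap_measurable _) (le_sup_right.trans hle) le_rfl
  exact (measurable_structVec_prod X z i).comp (Measurable.prodMk hq hw)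

variable [mΩ : MeasurableSpace Ω] {μ : Measure Ω} [IsProbabilityMeasure μ]
  {X : Fin n → EuclideanSpace ℝ (Fin d)} {Y : Ω → Fin n → ℝ} {q : ℕ → Ω → TreeStructure d}
  {w : ℕ → Ω → Finset (Fin n)} {s : ℕ} {Q : Set (TreeStructure d)}

lemma history_le (hY : Measurable Y) (hq : ∀ b, Measurable (q b)) (hw : ∀ b, Measurable (w b))
    (b : ℕ) : history Y q w b ≤ mΩ :=
  sup_le hY.comap_le (iSup_le fun j => sup_le (hq j).comap_le (hw j).comap_le)

/-- The sets of size `s` already carry total mass one, which leaves nothing for the others. -/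
lemma UniformSubsampling.real_preimage_singleton (hsub : UniformSubsampling μ Y q w s)
    (hsn : s ≤ n) (b : ℕ) (v : Finset (Fin n)) :
    μ.real (w b ⁻¹' {v}) = if v.card = s then 1 / (n.choose s : ℝ) else 0 := by
  split_ifs with hv
  · exact hsub.uniform b v hv
  have hm : ∀ v, MeasurableSet (w b ⁻¹' {v}) := fun v =>
    hsub.measurable b (measurableSet_singleton v)
  have h1 : ∑ v ∈ Finset.powersetCard s Finset.univ, μ.real (w b ⁻¹' {v}) = 1 := by
    rw [Finset.sum_congr rfl fun v hv => hsub.uniform b v (Finset.mem_powersetCard.1 hv).2]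
    have : (n.choose s : ℝ) ≠ 0 := by exact_mod_cast (Nat.choose_pos hsn).ne'
    simp [this]
  have h2 : ∑ v ∈ insert v (Finset.powersetCard s Finset.univ), μ.real (w b ⁻¹' {v}) ≤ 1 := by
    rw [sum_measureReal_preimage_singleton _ fun v _ => hm v]
    exact measureReal_le_one
  rw [Finset.sum_insert (by simp [hv]), h1] at h2
  exact le_antisymm (by linarith) measureReal_nonneg

/-- Given the past, the conditional probability that a structure entry lies in a measurable set is
one and the same function of the responses in all steps. -/
lemma exists_conditional_probability (hY : Measurable Y)
    (hsub : UniformSubsampling μ Y q w s) (hna : NonAdaptive μ Y q w Q) (hsn : s ≤ n)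
    (z : EuclideanSpace ℝ (Fin d)) (i : Fin n) {B : Set ℝ} (hB : MeasurableSet B) :
    ∃ g : (Fin n → ℝ) → ℝ, Measurable g ∧ Integrable g (μ.map Y) ∧
      ∀ b H, MeasurableSet[history Y q w b] H →
        μ.real ((fun ω => structVec X (q b ω) (w b ω) z i) ⁻¹' B ∩ H) = ∫ ω in H, g (Y ω) ∂μ := by
  obtain ⟨κ, hκ, hlaw⟩ := hna.condLaw
  have hPY : IsProbabilityMeasure (μ.map Y) := Measure.isProbabilityMeasure_map hY.aemeasurable
  set E : Finset (Fin n) → Set (TreeStructure d) := fun v => (structVec X · v z i) ⁻¹' B with hE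
  have hEm : ∀ v, MeasurableSet (E v) := fun v => measurable_structVec X v z i hB
  have hκm : ∀ v, Measurable fun y => (κ y).real (E v) := fun v =>
    (κ.measurable_coe (hEm v)).ennreal_toReal
  have hκi : ∀ v, Integrable (fun y => (κ y).real (E v)) (μ.map Y) := fun v =>
    Integrable.of_bound (hκm v).aestronglyMeasurable 1 (Eventually.of_forall fun y => by
      rw [Real.norm_of_nonneg measureReal_nonneg]; exact measureReal_le_one)
  -- Conditionally on the past, the subsample takes the value `v` with its uniform weight, and the
  -- tree structure then falls into `E v` with probability `κ y (E v)`.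
  refine ⟨fun y => ∑ v, (if v.card = s then 1 / (n.choose s : ℝ) else 0) * (κ y).real (E v),
    Finset.measurable_sum _ fun v _ => (hκm v).const_mul _,
    integrable_finsetSum _ fun v _ => (hκi v).const_mul _, fun b H hH => ?_⟩
  have hle := history_le hY hna.measurable hsub.measurable b
  have hH' : MeasurableSet H := hle H hH
  set A := (fun ω => structVec X (q b ω) (w b ω) z i) ⁻¹' B ∩ H with hA
  have hsplit : μ.real A = ∑ v, μ.real (w b ⁻¹' {v} ∩ A) := by
    have := sum_measureReal_preimage_singleton (μ := μ.restrict A) (f := w b) Finset.univ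
      fun v _ => hsub.measurable b (measurableSet_singleton v)
    simp only [Finset.coe_univ, Set.preimage_univ, measureReal_restrict_apply_univ] at this
    rw [← this]
    refine Finset.sum_congr rfl fun v _ => ?_
    rw [measureReal_restrict_apply (hsub.measurable b (measurableSet_singleton v))]
  have hterm : ∀ v, μ.real (w b ⁻¹' {v} ∩ A) =
      (if v.card = s then 1 / (n.choose s : ℝ) else 0) * ∫ ω in H, (κ (Y ω)).real (E v) ∂μ := by
    intro v
    have h1 : w b ⁻¹' {v} ∩ A = w b ⁻¹' {v} ∩ (q b ⁻¹' E v ∩ H) := by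
      ext ω
      simp only [hA, hE, Set.mem_inter_iff, Set.mem_preimage, Set.mem_singleton_iff]
      constructor
      · rintro ⟨rfl, h⟩; exact ⟨rfl, h⟩
      · rintro ⟨rfl, h⟩; exact ⟨rfl, h⟩
    -- The subsample is independent of the past and the current tree structure jointly.
    have h2 : μ.real (w b ⁻¹' {v} ∩ (q b ⁻¹' E v ∩ H)) =
        μ.real (w b ⁻¹' {v}) * μ.real (q b ⁻¹' E v ∩ H) := by
      have := (Indep_iff _ _ μ).1 (hsub.indep b) (w b ⁻¹' {v}) (q b ⁻¹' E v ∩ H)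
        ⟨{v}, measurableSet_singleton v, rfl⟩
        (MeasurableSet.inter
          ((le_sup_right : _ ≤ history Y q w b ⊔ _) _ ⟨E v, hEm v, rfl⟩)
          ((le_sup_left : history Y q w b ≤ _) _ hH))
      simp only [Measure.real, this, ENNReal.toReal_mul]
    have h3 : μ.real (q b ⁻¹' E v ∩ H) = ∫ ω in H, (κ (Y ω)).real (E v) ∂μ := by
      have hqm : MeasurableSet (q b ⁻¹' E v) := hna.measurable b (hEm v)
      have hce := setIntegral_condExp (μ := μ) hle
        (f := (q b ⁻¹' E v).indicator fun _ => (1 : ℝ))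
        ((integrable_const 1).indicator hqm) hH
      rw [setIntegral_congr_ae hH' ((hlaw b (E v) (hEm v)).mono fun ω h _ => h)] at hce
      rw [hce, setIntegral_indicator hqm, setIntegral_const, smul_eq_mul, mul_one, Set.inter_comm]
    rw [h1, h2, h3, hsub.real_preimage_singleton hsn]
  rw [hsplit, Finset.sum_congr rfl fun v _ => hterm v, integral_finsetSum]
  · simp only [integral_const_mul]
  · exact fun v _ => (((hκi v).comp_measurable hY).const_mul _).integrableOn

/-- The structure entries of every step have the same law and are independent of the past. -/
lemma real_structVec_inter (hY : Measurable Y)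
    (hsub : UniformSubsampling μ Y q w s) (hna : NonAdaptive μ Y q w Q)
    (hsvi : StructureValueIsolation μ X Y q w) (hsn : s ≤ n)
    (z : EuclideanSpace ℝ (Fin d)) (i : Fin n) {B : Set ℝ} (hB : MeasurableSet B)
    (b : ℕ) {H : Set Ω} (hH : MeasurableSet[history Y q w b] H) :
    μ.real ((fun ω => structVec X (q b ω) (w b ω) z i) ⁻¹' B ∩ H) =
      μ.real ((fun ω => structVec X (q 0 ω) (w 0 ω) z i) ⁻¹' B) * μ.real H := by
  obtain ⟨g, hgm, hgi, hg⟩ := exists_conditional_probability (X := X) hY hsub hna hsn z i hB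
  set p := μ.real ((fun ω => structVec X (q 0 ω) (w 0 ω) z i) ⁻¹' B) with hp
  have hPY : IsProbabilityMeasure (μ.map Y) := Measure.isProbabilityMeasure_map hY.aemeasurable
  -- Since `Y` belongs to the history at step `0`, isolation at that step says that `g` has the same
  -- integral as the constant `p` over every set of responses.
  have hae : g =ᵐ[μ.map Y] fun _ => p := by
    refine Integrable.ae_eq_of_forall_setIntegral_eq _ _ hgi (integrable_const p)
      fun F hF _ => ?_
    rw [setIntegral_map hF hgm.aestronglyMeasurable hY.aemeasurable,
      ← hg 0 (Y ⁻¹' F) ((le_sup_left : MeasurableSpace.comap Y inferInstance ≤ _) _ ⟨F, hF, rfl⟩)]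
    have h := (hsvi 0 z i).measure_inter_preimage_eq_mul B F hB hF
    simp only [Measure.real, h, ENNReal.toReal_mul, hp, setIntegral_const, smul_eq_mul,
      Measure.map_apply hY hF]
    ring
  have hae' : ∀ᵐ ω ∂μ, g (Y ω) = p := ae_of_ae_map hY.aemeasurable hae
  have hH' := history_le hY hna.measurable hsub.measurable b H hH
  rw [hg b H hH, setIntegral_congr_ae hH' (hae'.mono fun ω h _ => h), setIntegral_const,
    smul_eq_mul, mul_comm]

lemma measurable_structVec_comp (hq : ∀ b, Measurable (q b)) (hw : ∀ b, Measurable (w b))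
    (z : EuclideanSpace ℝ (Fin d)) (i : Fin n) (b : ℕ) :
    Measurable fun ω => structVec X (q b ω) (w b ω) z i :=
  (measurable_structVec_prod X z i).comp ((hq b).prodMk (hw b))

lemma integrable_structVec (hq : ∀ b, Measurable (q b)) (hw : ∀ b, Measurable (w b))
    (z : EuclideanSpace ℝ (Fin d)) (i : Fin n) (b : ℕ) :
    Integrable (fun ω => structVec X (q b ω) (w b ω) z i) μ :=
  Integrable.of_bound (measurable_structVec_comp hq hw z i b).aestronglyMeasurable 1
    (Eventually.of_forall fun ω => by
      rw [Real.norm_of_nonneg (structVec_nonneg ..)]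
      exact structVec_le_one ..)

/-- Strong law of large numbers for the structure vectors of the ensemble. -/
theorem ae_tendsto_average_structVec (hY : Measurable Y)
    (hsub : UniformSubsampling μ Y q w s) (hna : NonAdaptive μ Y q w Q)
    (hsvi : StructureValueIsolation μ X Y q w) (hsn : s ≤ n)
    (z : EuclideanSpace ℝ (Fin d)) (i : Fin n) :
    ∀ᵐ ω ∂μ, Tendsto (fun b : ℕ =>
      (∑ j ∈ Finset.range b, structVec X (q j ω) (w j ω) z i) / b) atTop
        (𝓝 (kVec μ X (q 0) (w 0) z i)) := by
  set S : ℕ → Ω → ℝ := fun b ω => structVec X (q b ω) (w b ω) z i with hS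
  have hm : ∀ b, Measurable (S b) := measurable_structVec_comp hna.measurable hsub.measurable z i
  have hlaw : ∀ b (B : Set ℝ), MeasurableSet B → μ.real (S b ⁻¹' B) = μ.real (S 0 ⁻¹' B) :=
    fun b B hB => by
      have := real_structVec_inter hY hsub hna hsvi hsn z i hB b
        (@MeasurableSet.univ _ (history Y q w b))
      simpa using this
  -- An earlier entry is measurable with respect to the history at step `b`. Pairwise independence
  -- is all that the strong law requires.
  have hind : ∀ j b, j < b → IndepFun (S b) (S j) μ := fun j b hjb => by
    refine indepFun_iff_measure_inter_preimage_eq_mul.2 fun B C hB hC => ?_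
    have h := real_structVec_inter hY hsub hna hsvi hsn z i hB b
      (measurable_structVec_history (Y := Y) (q := q) (w := w) X z i hjb hC)
    refine (ENNReal.toReal_eq_toReal_iff' (measure_ne_top _ _)
      (ENNReal.mul_ne_top (measure_ne_top _ _) (measure_ne_top _ _))).1 ?_
    rw [ENNReal.toReal_mul]
    change μ.real (S b ⁻¹' B ∩ S j ⁻¹' C) = μ.real (S b ⁻¹' B) * μ.real (S j ⁻¹' C)
    rw [hlaw b B hB]
    exact h
  refine strong_law_ae_real S (integrable_structVec hna.measurable hsub.measurable z i 0)
    (fun j b hjb => ?_) fun b => ⟨(hm b).aemeasurable, (hm 0).aemeasurable, ?_⟩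
  · rcases lt_or_gt_of_ne hjb with h | h
    · exact (hind j b h).symm
    · exact hind b j h
  · refine Measure.ext fun B hB => ?_
    rw [Measure.map_apply (hm b) hB, Measure.map_apply (hm 0) hB]
    exact (ENNReal.toReal_eq_toReal_iff' (measure_ne_top _ _) (measure_ne_top _ _)).1
      (hlaw b B hB)

end

section

/-! ### Leaves -/

section Leaves

variable {d n : ℕ} {t : TreeStructure d} {u v z : EuclideanSpace ℝ (Fin d)}

lemma TreeStructure.SameLeaf.symm (h : t.SameLeaf u v) : t.SameLeaf v u := by
  obtain ⟨A, hA, hu, hv⟩ := h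
  exact ⟨A, hA, hv, hu⟩

lemma TreeStructure.sameLeaf_iff_mem {A : Set (EuclideanSpace ℝ (Fin d))} (hA : A ∈ t.leaves)
    (hu : u ∈ A) : t.SameLeaf u v ↔ v ∈ A := by
  refine ⟨fun ⟨B, hB, huB, hvB⟩ => ?_, fun hv => ⟨A, hA, hu, hv⟩⟩
  rwa [t.pairwiseDisjoint.elim_set hA hB u hu huB]

lemma TreeStructure.SameLeaf.congr_left (h : t.SameLeaf u v) :
    t.SameLeaf u z ↔ t.SameLeaf v z := by
  obtain ⟨A, hA, hu, hv⟩ := h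
  rw [sameLeaf_iff_mem hA hu, sameLeaf_iff_mem hA hv]

lemma TreeStructure.exists_leaf (t : TreeStructure d) (hz : z ∈ unitCube d) :
    ∃ A ∈ t.leaves, z ∈ A := by
  rwa [← t.sUnion_leaves] at hz

lemma isBounded_unitCube (d : ℕ) : Bornology.IsBounded (unitCube d) := by
  refine Metric.isBounded_closedBall (x := (0 : EuclideanSpace ℝ (Fin d))) (r := √d) |>.subset ?_
  intro z hz
  rw [mem_closedBall_zero_iff, EuclideanSpace.norm_eq]
  refine Real.sqrt_le_sqrt ?_
  calc ∑ i, ‖z i‖ ^ 2 ≤ ∑ _i : Fin d, (1 : ℝ) := by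
        refine Finset.sum_le_sum fun i _ => ?_
        rw [Real.norm_of_nonneg (hz i).1]
        exact pow_le_one₀ (hz i).1 (hz i).2
    _ = d := by simp

lemma TreeStructure.SameLeaf.dist_le {δ : ℝ} (h : t.SameLeaf u v)
    (hδ : ∀ A ∈ t.leaves, Metric.diam A ≤ δ) : dist v u ≤ δ := by
  obtain ⟨A, hA, hu, hv⟩ := h
  have hsub : A ⊆ unitCube d := by
    rw [← t.sUnion_leaves]
    exact Set.subset_sUnion_of_mem hA
  exact (Metric.dist_le_diam_of_mem ((isBounded_unitCube d).subset hsub) hv hu).trans (hδ A hA)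

end Leaves

/-! ### Averages over the subsamples -/

section SubsampleMean

variable {d n : ℕ} (X : Fin n → EuclideanSpace ℝ (Fin d)) (t : TreeStructure d) (s : ℕ)

/-- The structure vector averaged over all subsamples of size `s`. -/
def subsampleMean (z : EuclideanSpace ℝ (Fin d)) (i : Fin n) : ℝ :=
  ∑ v ∈ Finset.powersetCard s Finset.univ, 1 / (n.choose s : ℝ) * structVec X t v z i

lemma subsampleMean_nonneg (z : EuclideanSpace ℝ (Fin d)) (i : Fin n) :
    0 ≤ subsampleMean X t s z i :=
  Finset.sum_nonneg fun v _ => mul_nonneg (by positivity) (structVec_nonneg ..)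

variable {X t}

lemma structVec_eq_zero {w : Finset (Fin n)} {z : EuclideanSpace ℝ (Fin d)} {i : Fin n}
    (h : ¬ t.SameLeaf z (X i)) : structVec X t w z i = 0 := by
  simp [structVec, h]

lemma structVec_congr_point {w : Finset (Fin n)} {z z' : EuclideanSpace ℝ (Fin d)}
    (h : t.SameLeaf z z') (i : Fin n) : structVec X t w z i = structVec X t w z' i := by
  have hz : t.SameLeaf z = t.SameLeaf z' := funext fun _ => propext h.congr_left
  unfold structVec
  rw [hz]

/-- Transposing two sample points of the leaf permutes the sample points in the leaf and preserves
the number of them in the subsample. -/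
lemma structVec_map_swap {z : EuclideanSpace ℝ (Fin d)} {i j : Fin n}
    (hi : t.SameLeaf z (X i)) (hj : t.SameLeaf z (X j)) (v : Finset (Fin n)) :
    structVec X t (v.map (Equiv.swap i j).toEmbedding) z j = structVec X t v z i := by
  classical
  have hmem : j ∈ v.map (Equiv.swap i j).toEmbedding ↔ i ∈ v := by
    rw [Finset.mem_map_equiv]
    simp
  have hP : ∀ l, t.SameLeaf z (X (Equiv.swap i j l)) ↔ t.SameLeaf z (X l) := fun l => by
    rcases eq_or_ne l i with rfl | h1
    · simp [hi, hj]
    rcases eq_or_ne l j with rfl | h2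
    · simp [hi, hj]
    rw [Equiv.swap_apply_of_ne_of_ne h1 h2]
  unfold structVec
  rw [Finset.filter_map, Finset.card_map]
  simp only [hmem, hi, hj, true_and, Function.comp_def, Equiv.coe_toEmbedding, hP]

/-- Sample points of one leaf are exchangeable under subsampling. -/
lemma subsampleMean_eq_of_sameLeaf {z : EuclideanSpace ℝ (Fin d)} {i j : Fin n}
    (hi : t.SameLeaf z (X i)) (hj : t.SameLeaf z (X j)) :
    subsampleMean X t s z i = subsampleMean X t s z j := by
  unfold subsampleMean
  -- The transposition acts as an involution on the subsamples of size `s`.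
  refine Finset.sum_bij' (fun v _ => v.map (Equiv.swap i j).toEmbedding)
    (fun v _ => v.map (Equiv.swap i j).toEmbedding) ?_ ?_ ?_ ?_ ?_
  · intro v hv
    simpa [Finset.mem_powersetCard] using hv
  · intro v hv
    simpa [Finset.mem_powersetCard] using hv
  · intro v _
    ext l
    simp [Finset.mem_map_equiv]
  · intro v _
    ext l
    simp [Finset.mem_map_equiv]
  · intro v _
    rw [structVec_map_swap hi hj]

lemma subsampleMean_symm (i j : Fin n) :
    subsampleMean X t s (X i) j = subsampleMean X t s (X j) i := by
  by_cases h : t.SameLeaf (X i) (X j)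
  · have hjj : t.SameLeaf (X j) (X j) := h.congr_left.1 h
    rw [← subsampleMean_eq_of_sameLeaf s hjj h.symm]
    simp only [subsampleMean, structVec_congr_point h]
  · have h' : ¬ t.SameLeaf (X j) (X i) := fun h' => h h'.symm
    simp [subsampleMean, structVec_eq_zero h, structVec_eq_zero h']

/-- Every entry of the averaged structure vector is at most its total mass divided by the minimal
number of points in a leaf. -/
lemma mul_subsampleMean_le_sum {N : ℝ}
    (hN : ∀ A ∈ t.leaves, N ≤ (leafCount X A : ℝ)) (z : EuclideanSpace ℝ (Fin d)) (i : Fin n) :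
    N * subsampleMean X t s z i ≤ ∑ j, subsampleMean X t s z j := by
  classical
  by_cases h : t.SameLeaf z (X i)
  · obtain ⟨A, hA, hz, hi⟩ := id h
    calc N * subsampleMean X t s z i ≤ (leafCount X A : ℝ) * subsampleMean X t s z i :=
          mul_le_mul_of_nonneg_right (hN A hA) (subsampleMean_nonneg ..)
      _ = ∑ j ∈ Finset.univ.filter fun j => X j ∈ A, subsampleMean X t s z j := by
          rw [Finset.sum_congr rfl fun j hj => subsampleMean_eq_of_sameLeaf s
            ((t.sameLeaf_iff_mem hA hz).2 (Finset.mem_filter.1 hj).2) h, Finset.sum_const,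
            nsmul_eq_mul, leafCount]
      _ ≤ _ := Finset.sum_le_sum_of_subset_of_nonneg (Finset.filter_subset _ _)
          fun j _ _ => subsampleMean_nonneg ..
  · have h0 : subsampleMean X t s z i = 0 := by simp [subsampleMean, structVec_eq_zero h]
    rw [h0, mul_zero]
    exact Finset.sum_nonneg fun j _ => subsampleMean_nonneg ..

/-- Some subsample of size `s` contains a sample point of the leaf of `z`, and this one subsample
contributes positive mass. -/
lemma sum_subsampleMean_pos {s : ℕ} (hs1 : 1 ≤ s) (hsn : s ≤ n)
    (hN : ∀ A ∈ t.leaves, 0 < leafCount X A) {z : EuclideanSpace ℝ (Fin d)}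
    (hz : z ∈ unitCube d) : 0 < ∑ j, subsampleMean X t s z j := by
  classical
  obtain ⟨A, hA, hzA⟩ := t.exists_leaf hz
  obtain ⟨i, hi⟩ := Finset.card_pos.1 (hN A hA)
  have hiz : t.SameLeaf z (X i) := ⟨A, hA, hzA, (Finset.mem_filter.1 hi).2⟩
  refine Finset.sum_pos' (fun j _ => subsampleMean_nonneg ..) ⟨i, Finset.mem_univ i, ?_⟩
  obtain ⟨v, hv1, -, hv2⟩ := Finset.exists_subsuperset_card_eq (Finset.subset_univ {i})
    (by simpa using hs1) (by simpa using hsn)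
  have hiv : i ∈ v := hv1 (Finset.mem_singleton_self i)
  refine Finset.sum_pos' (fun w _ => mul_nonneg (by positivity) (structVec_nonneg ..))
    ⟨v, by simp [Finset.mem_powersetCard, hv2], ?_⟩
  have hc : (0 : ℝ) < n.choose s := by exact_mod_cast Nat.choose_pos hsn
  refine mul_pos (by positivity) ?_
  unfold structVec
  rw [if_pos ⟨hiz, hiv⟩]
  refine div_pos one_pos ?_
  exact_mod_cast Finset.card_pos.2 ⟨i, Finset.mem_filter.2 ⟨hiv, hiz⟩⟩

end SubsampleMean

/-! ### The expected structure vectors -/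

section ExpectedStructure

variable {Ω : Type*} {d n : ℕ} [MeasurableSpace Ω] {μ : Measure Ω}
  {X : Fin n → EuclideanSpace ℝ (Fin d)} {Y : Ω → Fin n → ℝ} {q : ℕ → Ω → TreeStructure d}
  {w : ℕ → Ω → Finset (Fin n)} {s : ℕ} {Q : Set (TreeStructure d)}

lemma kVec_nonneg (X : Fin n → EuclideanSpace ℝ (Fin d)) (q : Ω → TreeStructure d)
    (w : Ω → Finset (Fin n)) (z : EuclideanSpace ℝ (Fin d)) (i : Fin n) :
    0 ≤ kVec μ X q w z i :=
  integral_nonneg fun _ => structVec_nonneg ..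

lemma kVec_eq_zero_of_lt_dist (hna : NonAdaptive μ Y q w Q) {δ : ℝ}
    (hδ : ∀ t ∈ Q, ∀ A ∈ t.leaves, Metric.diam A ≤ δ) {z : EuclideanSpace ℝ (Fin d)} {i : Fin n}
    (hi : δ < dist (X i) z) : kVec μ X (q 0) (w 0) z i = 0 := by
  refine integral_eq_zero_of_ae ?_
  filter_upwards [hna.mem 0] with ω hω
  exact structVec_eq_zero fun h => hi.not_ge (h.dist_le (hδ _ hω))

/-- Cauchy-Schwarz on the support of `k`, which the leaf diameters confine to the ball of radius
`δ`. -/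
lemma sq_sum_kVec_le (hna : NonAdaptive μ Y q w Q) {δ : ℝ}
    (hδ : ∀ t ∈ Q, ∀ A ∈ t.leaves, Metric.diam A ≤ δ) (z : EuclideanSpace ℝ (Fin d)) :
    (∑ i, kVec μ X (q 0) (w 0) z i) ^ 2 ≤
      (nbhdCount X z δ : ℝ) * ∑ i, kVec μ X (q 0) (w 0) z i ^ 2 := by
  classical
  have hsupp : ∑ i ∈ Finset.univ.filter fun i => dist (X i) z ≤ δ, kVec μ X (q 0) (w 0) z i =
      ∑ i, kVec μ X (q 0) (w 0) z i := by
    refine Finset.sum_subset (Finset.filter_subset _ _) fun i _ hi => ?_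
    exact kVec_eq_zero_of_lt_dist hna hδ (by simpa using hi)
  have hcard : (nbhdCount X z δ : ℝ) =
      ((Finset.univ.filter fun i => dist (X i) z ≤ δ).card : ℝ) := by
    unfold nbhdCount
    congr!
  rw [← hsupp, hcard]
  refine sq_sum_le_card_mul_sum_sq.trans ?_
  gcongr
  exact Finset.filter_subset _ _

variable [IsProbabilityMeasure μ]

lemma sum_kVec_le_one (hq : ∀ b, Measurable (q b)) (hw : ∀ b, Measurable (w b))
    (z : EuclideanSpace ℝ (Fin d)) : ∑ i, kVec μ X (q 0) (w 0) z i ≤ 1 := by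
  unfold kVec
  rw [← integral_finsetSum _ fun i _ => integrable_structVec hq hw z i 0]
  calc _ ≤ ∫ _ω, (1 : ℝ) ∂μ := integral_mono
        (integrable_finsetSum _ fun i _ => integrable_structVec hq hw z i 0)
        (integrable_const 1) fun ω => sum_structVec_le_one ..
    _ = 1 := by simp

lemma integrable_structVec_fixed (hq : ∀ b, Measurable (q b)) (v : Finset (Fin n))
    (z : EuclideanSpace ℝ (Fin d)) (i : Fin n) :
    Integrable (fun ω => structVec X (q 0 ω) v z i) μ :=
  integrable_structVec (w := fun _ _ => v) hq (fun _ => measurable_const) z i 0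

lemma integrable_subsampleMean (hq : ∀ b, Measurable (q b))
    (z : EuclideanSpace ℝ (Fin d)) (i : Fin n) :
    Integrable (fun ω => subsampleMean X (q 0 ω) s z i) μ :=
  integrable_finsetSum _ fun v _ => (integrable_structVec_fixed hq v z i).const_mul _

/-- Averaging out the subsample first. -/
lemma kVec_eq_integral_subsampleMean (hsub : UniformSubsampling μ Y q w s)
    (hq : ∀ b, Measurable (q b)) (hsn : s ≤ n) (z : EuclideanSpace ℝ (Fin d)) (i : Fin n) :
    kVec μ X (q 0) (w 0) z i = ∫ ω, subsampleMean X (q 0 ω) s z i ∂μ := by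
  classical
  have hm : ∀ v, MeasurableSet (w 0 ⁻¹' {v}) := fun v =>
    hsub.measurable 0 (measurableSet_singleton v)
  -- Expansion over the finitely many values of the subsample; each summand is a product of
  -- independent factors.
  have hdec : ∀ ω, structVec X (q 0 ω) (w 0 ω) z i =
      ∑ v, (w 0 ⁻¹' {v}).indicator 1 ω * structVec X (q 0 ω) v z i := fun ω => by
    rw [Finset.sum_eq_single (w 0 ω)]
    · simp
    · intro v _ hv
      rw [Set.indicator_of_notMem (fun h => hv h.symm), zero_mul]
    · simp
  have hind : IndepFun (w 0) (q 0) μ := indep_of_indep_of_le_right (hsub.indep 0) le_sup_right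
  have hterm : ∀ v, ∫ ω, (w 0 ⁻¹' {v}).indicator 1 ω * structVec X (q 0 ω) v z i ∂μ =
      (if v.card = s then 1 / (n.choose s : ℝ) else 0) *
        ∫ ω, structVec X (q 0 ω) v z i ∂μ := fun v => by
    have hφ : Measurable (({v} : Set (Finset (Fin n))).indicator (1 : Finset (Fin n) → ℝ)) :=
      measurable_one.indicator (measurableSet_singleton v)
    have := (hind.comp hφ (measurable_structVec X v z i)).integral_fun_mul_eq_mul_integral
      (hφ.comp (hsub.measurable 0)).aestronglyMeasurable
      ((measurable_structVec X v z i).comp (hq 0)).aestronglyMeasurable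
    refine this.trans ?_
    rw [← hsub.real_preimage_singleton hsn 0 v, ← integral_indicator_one (hm v)]
    rfl
  have hinteg : ∀ v, Integrable
      (fun ω => (w 0 ⁻¹' {v}).indicator 1 ω * structVec X (q 0 ω) v z i) μ := fun v =>
    (integrable_structVec_fixed hq v z i).bdd_mul (c := 1)
      (measurable_one.indicator (hm v)).aestronglyMeasurable
      (Eventually.of_forall fun ω => by
        by_cases h : ω ∈ w 0 ⁻¹' {v}
        · rw [Set.indicator_of_mem h]; simp
        · rw [Set.indicator_of_notMem h]; simp)
  unfold kVec subsampleMean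
  simp_rw [hdec]
  rw [integral_finsetSum _ fun v _ => hinteg v,
    integral_finsetSum _ fun v _ => (integrable_structVec_fixed hq v z i).const_mul _]
  simp only [hterm, integral_const_mul, ite_mul, zero_mul]
  rw [← Finset.sum_filter]
  refine Finset.sum_congr ?_ fun _ _ => rfl
  ext v
  simp [Finset.mem_powersetCard]

/-- For a single subsample the structure matrix need not be symmetric; averaging over all subsamples
of one size makes it so. -/
lemma kMat_symm (hsub : UniformSubsampling μ Y q w s) (hq : ∀ b, Measurable (q b)) (hsn : s ≤ n)
    (i j : Fin n) : kMat μ X (q 0) (w 0) i j = kMat μ X (q 0) (w 0) j i := by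
  simp only [kMat, Matrix.of_apply, kVec_eq_integral_subsampleMean hsub hq hsn,
    subsampleMean_symm s i j]

/-- The total mass stays on the right because it can be below one: a subsample that misses the leaf
gives the zero vector. -/
lemma mul_kVec_le_sum (hsub : UniformSubsampling μ Y q w s) (hna : NonAdaptive μ Y q w Q)
    (hsn : s ≤ n) {N : ℝ} (hN : ∀ t ∈ Q, ∀ A ∈ t.leaves, N ≤ (leafCount X A : ℝ))
    (z : EuclideanSpace ℝ (Fin d)) (i : Fin n) :
    N * kVec μ X (q 0) (w 0) z i ≤ ∑ j, kVec μ X (q 0) (w 0) z j := by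
  simp only [kVec_eq_integral_subsampleMean hsub hna.measurable hsn]
  rw [← integral_const_mul,
    ← integral_finsetSum _ fun j _ => integrable_subsampleMean hna.measurable z j]
  refine integral_mono_ae ((integrable_subsampleMean hna.measurable z i).const_mul _)
    (integrable_finsetSum _ fun j _ => integrable_subsampleMean hna.measurable z j) ?_
  filter_upwards [hna.mem 0] with ω hω
  exact mul_subsampleMean_le_sum s (hN _ hω) z i

lemma sum_kVec_pos (hsub : UniformSubsampling μ Y q w s) (hna : NonAdaptive μ Y q w Q)
    (hs1 : 1 ≤ s) (hsn : s ≤ n) (hN : ∀ t ∈ Q, ∀ A ∈ t.leaves, 0 < leafCount X A)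
    {z : EuclideanSpace ℝ (Fin d)} (hz : z ∈ unitCube d) :
    0 < ∑ j, kVec μ X (q 0) (w 0) z j := by
  simp only [kVec_eq_integral_subsampleMean hsub hna.measurable hsn]
  have hinteg : Integrable (fun ω => ∑ j, subsampleMean X (q 0 ω) s z j) μ :=
    integrable_finsetSum _ fun j _ => integrable_subsampleMean hna.measurable z j
  rw [← integral_finsetSum _ fun j _ => integrable_subsampleMean hna.measurable z j]
  have hnn : 0 ≤ᵐ[μ] fun ω => ∑ j, subsampleMean X (q 0 ω) s z j :=
    Eventually.of_forall fun ω => Finset.sum_nonneg fun j _ => subsampleMean_nonneg ..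
  refine lt_of_le_of_ne (integral_nonneg_of_ae hnn) fun h => ?_
  have h0 := (integral_eq_zero_iff_of_nonneg_ae hnn hinteg).1 h.symm
  obtain ⟨ω, h1, h2⟩ := (h0.and (hna.mem 0)).exists
  exact (sum_subsampleMean_pos hs1 hsn (hN _ h2) hz).ne' h1

end ExpectedStructure

/-! ### Substochastic matrices -/

section Substochastic

variable {n : ℕ} {lam : ℝ} {K : Matrix (Fin n) (Fin n) ℝ}

/-- Strict diagonal dominance, from `1 / lam > 1` and row sums at most one. -/
lemma det_inv_smul_one_add_ne_zero (hlam0 : 0 < lam) (hlam1 : lam < 1)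
    (hK0 : ∀ i j, 0 ≤ K i j) (hrow : ∀ i, ∑ j, K i j ≤ 1) :
    ((1 / lam) • (1 : Matrix (Fin n) (Fin n) ℝ) + K).det ≠ 0 := by
  refine det_ne_zero_of_sum_row_lt_diag fun i => ?_
  have hlam : 1 < 1 / lam := by rw [lt_div_iff₀ hlam0]; linarith
  have h1 : ∑ j ∈ Finset.univ.erase i, ‖((1 / lam) • (1 : Matrix (Fin n) (Fin n) ℝ) + K) i j‖ =
      ∑ j ∈ Finset.univ.erase i, K i j := by
    refine Finset.sum_congr rfl fun j hj => ?_
    simp [Matrix.one_apply_ne (Finset.ne_of_mem_erase hj).symm, abs_of_nonneg (hK0 i j)]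
  have h2 : ‖((1 / lam) • (1 : Matrix (Fin n) (Fin n) ℝ) + K) i i‖ = 1 / lam + K i i := by
    have := hK0 i i
    rw [Real.norm_of_nonneg]
    · simp
    · simp only [Matrix.add_apply, Matrix.smul_apply, Matrix.one_apply_eq, smul_eq_mul, mul_one]
      positivity
  have h3 := hrow i
  rw [← Finset.add_sum_erase _ _ (Finset.mem_univ i)] at h3
  rw [h1, h2]
  linarith [hK0 i i]

variable {r k : Fin n → ℝ}

/-- With column sums at most one, `r = lam * (k - rᵀ K)` gives `‖r‖ ≤ lam * (c + ‖r‖)` in the sup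
norm; this is solved for `‖r‖`. -/
lemma abs_mul_le_of_substochastic (hlam0 : 0 < lam) (hlam1 : lam < 1) (hK0 : ∀ i j, 0 ≤ K i j)
    (hcol : ∀ j, ∑ i, K i j ≤ 1) (hr : ∀ i, r i / lam + ∑ j, r j * K j i = k i) {c : ℝ}
    (hc : 0 ≤ c) (hk : ∀ i, |k i| ≤ c) (i : Fin n) : |r i| * (1 / lam - 1) ≤ c := by
  have hlam : 0 < 1 / lam - 1 := by rw [sub_pos, lt_div_iff₀ hlam0]; linarith
  have hsum : ∀ i, |∑ j, r j * K j i| ≤ ‖r‖ := fun i =>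
    calc |∑ j, r j * K j i| ≤ ∑ j, ‖r‖ * K j i := by
          refine (Finset.abs_sum_le_sum_abs _ _).trans (Finset.sum_le_sum fun j _ => ?_)
          rw [abs_mul, abs_of_nonneg (hK0 j i)]
          exact mul_le_mul_of_nonneg_right (norm_le_pi_norm r j) (hK0 j i)
      _ ≤ ‖r‖ * 1 := by
          rw [← Finset.mul_sum]
          exact mul_le_mul_of_nonneg_left (hcol i) (norm_nonneg r)
      _ = ‖r‖ := mul_one _
  have hb : ∀ i, |r i| ≤ lam * (c + ‖r‖) := fun i => by
    have h1 : r i = lam * (k i - ∑ j, r j * K j i) := by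
      rw [← hr i]; field_simp; ring
    rw [h1, abs_mul, abs_of_pos hlam0]
    gcongr
    exact (abs_sub _ _).trans (add_le_add (hk i) (hsum i))
  have hnorm : ‖r‖ ≤ lam * (c + ‖r‖) :=
    (pi_norm_le_iff_of_nonneg (by positivity)).2 hb
  have h2 : ‖r‖ * (1 / lam - 1) ≤ c := by
    have : ‖r‖ * (1 - lam) ≤ lam * c := by linarith
    have h3 : 1 / lam - 1 = (1 - lam) / lam := by field_simp
    rw [h3, ← mul_div_assoc, div_le_iff₀ hlam0]
    linarith
  exact (mul_le_mul_of_nonneg_right (norm_le_pi_norm r i) hlam.le).trans h2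

/-- Schur test: row and column sums at most one make `r ↦ rᵀ K` a contraction of `ℓ²`. The outer
factor `2` comes from `(a + b)² ≤ 2 a² + 2 b²`. The estimate serves as a lower bound for `‖r‖`. -/
lemma sum_sq_le_of_substochastic (hK0 : ∀ i j, 0 ≤ K i j) (hrow : ∀ i, ∑ j, K i j ≤ 1)
    (hcol : ∀ j, ∑ i, K i j ≤ 1) (hr : ∀ i, r i / lam + ∑ j, r j * K j i = k i) :
    ∑ i, k i ^ 2 ≤ 2 * ((1 / lam) ^ 2 + 1) * ∑ i, r i ^ 2 := by
  have hschur : ∀ i, (∑ j, r j * K j i) ^ 2 ≤ ∑ j, r j ^ 2 * K j i := fun i => by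
    have h := Finset.sum_sq_le_sum_mul_sum_of_sq_le_mul (Finset.univ : Finset (Fin n))
      (r := fun j => r j * K j i) (f := fun j => K j i) (g := fun j => r j ^ 2 * K j i)
      (fun j _ => hK0 j i) (fun j _ => mul_nonneg (sq_nonneg _) (hK0 j i))
      (fun j _ => le_of_eq (by ring))
    refine h.trans ?_
    have hnn : 0 ≤ ∑ j, r j ^ 2 * K j i :=
      Finset.sum_nonneg fun j _ => mul_nonneg (sq_nonneg _) (hK0 j i)
    nlinarith [hcol i]
  have htot : ∑ i, ∑ j, r j ^ 2 * K j i ≤ ∑ j, r j ^ 2 := by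
    rw [Finset.sum_comm]
    refine Finset.sum_le_sum fun j _ => ?_
    rw [← Finset.mul_sum]
    nlinarith [hrow j, sq_nonneg (r j)]
  calc ∑ i, k i ^ 2 ≤ ∑ i, (2 * (1 / lam) ^ 2 * r i ^ 2 + 2 * ∑ j, r j ^ 2 * K j i) := by
        refine Finset.sum_le_sum fun i _ => ?_
        rw [← hr i]
        have h1 := hschur i
        have h2 : r i / lam = 1 / lam * r i := by ring
        rw [h2]
        nlinarith [sq_nonneg (1 / lam * r i - ∑ j, r j * K j i)]
    _ = 2 * (1 / lam) ^ 2 * ∑ i, r i ^ 2 + 2 * ∑ i, ∑ j, r j ^ 2 * K j i := by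
        rw [Finset.sum_add_distrib, ← Finset.mul_sum, ← Finset.mul_sum]
    _ ≤ _ := by linarith

end Substochastic

end

section

/-! ### The limit of the Boulevard predictions -/

section Limit

variable {Ω : Type*} {d n : ℕ} [MeasurableSpace Ω] {μ : Measure Ω} [IsProbabilityMeasure μ]
  {X : Fin n → EuclideanSpace ℝ (Fin d)} {Y : Ω → Fin n → ℝ} {q : ℕ → Ω → TreeStructure d}
  {w : ℕ → Ω → Finset (Fin n)} {s : ℕ} {Q : Set (TreeStructure d)} {lam : ℝ}

lemma boulevard_of_isEmpty [IsEmpty (Fin n)] (lam M : ℝ) (X : Fin n → EuclideanSpace ℝ (Fin d))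
    (y : Fin n → ℝ) (q : ℕ → TreeStructure d) (w : ℕ → Finset (Fin n)) (b : ℕ)
    (z : EuclideanSpace ℝ (Fin d)) : boulevard lam M X y q w b z = 0 := by
  induction b with
  | zero => rfl
  | succ b ih => simp [boulevard, ih]

lemma isUnit_det_kMat (hlam0 : 0 < lam) (hlam1 : lam < 1) (hq : ∀ b, Measurable (q b))
    (hw : ∀ b, Measurable (w b)) :
    IsUnit ((1 / lam) • (1 : Matrix (Fin n) (Fin n) ℝ) + kMat μ X (q 0) (w 0)).det :=
  isUnit_iff_ne_zero.2 (det_inv_smul_one_add_ne_zero hlam0 hlam1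
    (fun _ _ => kVec_nonneg ..) fun i => sum_kVec_le_one hq hw (X i))

/-- The fixed point of the averaged iteration is small compared with the truncation level. -/
lemma abs_sub_le_of_fixedPoint {K : Matrix (Fin n) (Fin n) ℝ} {u y : Fin n → ℝ} {M : ℝ}
    (hlam0 : 0 < lam) (hlam1 : lam < 1) (hM : 0 ≤ M)
    (hK0 : ∀ i j, 0 ≤ K i j) (hrow : ∀ i, ∑ j, K i j ≤ 1)
    (hu : ∀ l, u l + lam * ∑ i, K l i * u i = y l) (hy : ∀ i, 1 / (1 - lam) * |y i| ≤ M)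
    (l : Fin n) : |y l - u l| ≤ M := by
  have h1 : 0 < 1 - lam := by linarith
  -- The factor `1 / (1 - lam)` is chosen for this: the fixed point satisfies `(1 - lam) ‖y - u‖ ≤
  -- lam ‖y‖`, so that `‖y - u‖ ≤ lam * M ≤ M`.
  have hy' : ‖y‖ ≤ (1 - lam) * M := (pi_norm_le_iff_of_nonneg (by positivity)).2 fun i => by
    have := hy i
    rw [one_div_mul_eq_div, div_le_iff₀ h1] at this
    rw [Real.norm_eq_abs]
    linarith
  have hb : ∀ l, ‖(y - u) l‖ ≤ lam * (‖y‖ + ‖y - u‖) := fun l => by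
    have heq : (y - u) l = lam * ∑ i, K l i * u i := by
      rw [Pi.sub_apply, ← hu l]; ring
    rw [heq, norm_mul, Real.norm_of_nonneg hlam0.le]
    gcongr
    calc ‖∑ i, K l i * u i‖ ≤ ∑ i, K l i * (‖y‖ + ‖y - u‖) := by
          refine (norm_sum_le _ _).trans (Finset.sum_le_sum fun i _ => ?_)
          rw [norm_mul, Real.norm_of_nonneg (hK0 l i)]
          refine mul_le_mul_of_nonneg_left ?_ (hK0 l i)
          have : u i = y i - (y - u) i := by simp
          rw [this]
          exact (norm_sub_le _ _).trans
            (add_le_add (norm_le_pi_norm y i) (norm_le_pi_norm (y - u) i))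
      _ ≤ 1 * (‖y‖ + ‖y - u‖) := by
          rw [← Finset.sum_mul]
          exact mul_le_mul_of_nonneg_right (hrow l) (by positivity)
      _ = _ := one_mul _
  have hnorm : ‖y - u‖ ≤ lam * (‖y‖ + ‖y - u‖) :=
    (pi_norm_le_iff_of_nonneg (by positivity)).2 hb
  have hfin : ‖y - u‖ ≤ M := by
    refine le_of_mul_le_mul_left ?_ h1
    have : (1 - lam) * ‖y - u‖ ≤ lam * ((1 - lam) * M) := by nlinarith
    nlinarith [mul_nonneg h1.le hM]
  exact (norm_le_pi_norm (y - u) l).trans hfin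

/-- Almost surely the Boulevard predictions converge to `rᵀ Y`, simultaneously for all truncation
levels that are large compared with the responses. -/
theorem ae_tendsto_boulevard (hlam0 : 0 < lam) (hlam1 : lam < 1) (hY : Measurable Y)
    (hsub : UniformSubsampling μ Y q w s) (hna : NonAdaptive μ Y q w Q)
    (hsvi : StructureValueIsolation μ X Y q w) (hsn : 1 ≤ n → s ≤ n)
    (x : EuclideanSpace ℝ (Fin d)) :
    ∀ᵐ ω ∂μ, ∀ M : ℝ, (∀ i, 1 / (1 - lam) * |Y ω i| ≤ M) →
      Tendsto (fun b => boulevard lam M X (Y ω) (fun j => q j ω) (fun j => w j ω) b x) atTop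
        (𝓝 (∑ i, rVec lam μ X (q 0) (w 0) x i * Y ω i)) := by
  rcases isEmpty_or_nonempty (Fin n) with hn | hn
  -- Without sample points the condition on `M` is void and `M` may be negative, so this case is
  -- separate.
  · simp only [boulevard_of_isEmpty, Finset.univ_eq_empty, Finset.sum_empty]
    exact Eventually.of_forall fun ω M _ => tendsto_const_nhds
  have i₀ : Fin n := hn.some
  have hsn' : s ≤ n := hsn (Nat.one_le_iff_ne_zero.2 i₀.pos.ne')
  have hk : ∀ z, ∀ᵐ ω ∂μ, ∀ i, Tendsto (fun b : ℕ =>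
      (∑ j ∈ Finset.range b, structVec X (q j ω) (w j ω) z i) / b) atTop
        (𝓝 (kVec μ X (q 0) (w 0) z i)) := fun z =>
    ae_all_iff.2 fun i => ae_tendsto_average_structVec hY hsub hna hsvi hsn' z i
  filter_upwards [hk x, ae_all_iff.2 fun l => hk (X l)] with ω hx hX M hM
  have hM0 : 0 ≤ M := by
    refine le_trans (mul_nonneg ?_ (abs_nonneg _)) (hM i₀)
    have : 0 < 1 - lam := by linarith
    positivity
  set K := kMat μ X (q 0) (w 0) with hK
  set A := (1 / lam) • (1 : Matrix (Fin n) (Fin n) ℝ) + K with hA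
  have hdet : IsUnit A.det := isUnit_det_kMat hlam0 hlam1 hna.measurable hsub.measurable
  -- The fixed-point residual is `u = g / lam`, and the limit `lam * kᵀ u` becomes `kᵀ A⁻¹ Y = rᵀ
  -- Y`.
  set g := A⁻¹ *ᵥ Y ω with hg
  have hAg : ∀ l, 1 / lam * g l + ∑ i, K l i * g i = Y ω l := fun l => by
    have h : A *ᵥ g = Y ω := by
      rw [hg, Matrix.mulVec_mulVec, Matrix.mul_nonsing_inv _ hdet, Matrix.one_mulVec]
    have h' := congrFun h l
    rw [hA, Matrix.add_mulVec, Matrix.smul_mulVec, Matrix.one_mulVec] at h'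
    exact h'
  have hK0 : ∀ i j, 0 ≤ K i j := fun _ _ => kVec_nonneg ..
  have hrow : ∀ i, ∑ j, K i j ≤ 1 := fun i =>
    sum_kVec_le_one hna.measurable hsub.measurable (X i)
  have hu : ∀ l, 1 / lam * g l + lam * ∑ i, K l i * (1 / lam * g i) = Y ω l := fun l => by
    rw [← hAg l, Finset.mul_sum]
    congr 1
    refine Finset.sum_congr rfl fun i _ => ?_
    field_simp
  have hlim := tendsto_boulevard (k := kVec μ X (q 0) (w 0)) (u := fun l => 1 / lam * g l)
    hlam0.le hlam1 hM0 (kVec_nonneg X (q 0) (w 0))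
    (fun z => sum_kVec_le_one hna.measurable hsub.measurable z) hx hX hu
    (abs_sub_le_of_fixedPoint hlam0 hlam1 hM0 hK0 hrow hu hM)
  convert hlim using 2
  calc ∑ i, rVec lam μ X (q 0) (w 0) x i * Y ω i
      = (kVec μ X (q 0) (w 0) x ᵥ* A⁻¹) ⬝ᵥ Y ω := rfl
    _ = kVec μ X (q 0) (w 0) x ⬝ᵥ g := by rw [← Matrix.dotProduct_mulVec]
    _ = _ := by
      rw [Finset.mul_sum]
      refine Finset.sum_congr rfl fun i _ => ?_
      field_simp

/-! ### Negligibility of the weights -/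

/-- The definition of `r` as a linear system, free of the inverse; all estimates on `r` start from
it. -/
lemma rVec_div_add_sum (hlam0 : 0 < lam) (hlam1 : lam < 1) (hq : ∀ b, Measurable (q b))
    (hw : ∀ b, Measurable (w b)) (x : EuclideanSpace ℝ (Fin d)) (i : Fin n) :
    rVec lam μ X (q 0) (w 0) x i / lam +
      ∑ j, rVec lam μ X (q 0) (w 0) x j * kMat μ X (q 0) (w 0) j i = kVec μ X (q 0) (w 0) x i := by
  have hdet : IsUnit ((1 / lam) • (1 : Matrix (Fin n) (Fin n) ℝ) + kMat μ X (q 0) (w 0)).det :=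
    isUnit_det_kMat hlam0 hlam1 hq hw
  have h : (rVec lam μ X (q 0) (w 0) x).ofLp ᵥ*
      ((1 / lam) • (1 : Matrix (Fin n) (Fin n) ℝ) + kMat μ X (q 0) (w 0)) =
        kVec μ X (q 0) (w 0) x := by
    rw [rVec, Matrix.vecMul_vecMul, Matrix.nonsing_inv_mul _ hdet, Matrix.vecMul_one]
  have h' := congrFun h i
  rw [Matrix.vecMul_add, Matrix.vecMul_smul, Matrix.vecMul_one] at h'
  rw [← h', Pi.add_apply, Pi.smul_apply, smul_eq_mul, one_div_mul_eq_div]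
  rfl

lemma sum_kMat_col_le_one (hsub : UniformSubsampling μ Y q w s) (hq : ∀ b, Measurable (q b))
    (hsn : s ≤ n) (j : Fin n) : ∑ i, kMat μ X (q 0) (w 0) i j ≤ 1 := by
  rw [Finset.sum_congr rfl fun i _ => kMat_symm hsub hq hsn i j]
  exact sum_kVec_le_one hq hsub.measurable (X j)

lemma rVec_ne_zero (hlam0 : 0 < lam) (hlam1 : lam < 1) (hsub : UniformSubsampling μ Y q w s)
    (hna : NonAdaptive μ Y q w Q) (hs1 : 1 ≤ s) (hsn : s ≤ n)
    (hN : ∀ t ∈ Q, ∀ A ∈ t.leaves, 0 < leafCount X A)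
    {x : EuclideanSpace ℝ (Fin d)} (hx : x ∈ unitCube d) :
    rVec lam μ X (q 0) (w 0) x ≠ 0 := fun h0 => by
  have hpos := sum_kVec_pos hsub hna hs1 hsn hN hx
  refine hpos.ne' (Finset.sum_eq_zero fun i _ => ?_)
  rw [← rVec_div_add_sum hlam0 hlam1 hna.measurable hsub.measurable x i, h0]
  simp

/-- Each weight is small compared with the norm of the weight vector as soon as the squared minimal
number of points in a leaf exceeds the number of points close to `x`. -/
lemma sq_rVec_le (hlam0 : 0 < lam) (hlam1 : lam < 1) (hsub : UniformSubsampling μ Y q w s)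
    (hna : NonAdaptive μ Y q w Q) (hsn : s ≤ n) {N δ : ℝ} (hN0 : 0 < N)
    (hN : ∀ t ∈ Q, ∀ A ∈ t.leaves, N ≤ (leafCount X A : ℝ))
    (hδ : ∀ t ∈ Q, ∀ A ∈ t.leaves, Metric.diam A ≤ δ)
    (x : EuclideanSpace ℝ (Fin d)) (i : Fin n) :
    rVec lam μ X (q 0) (w 0) x i ^ 2 ≤ 2 * ((1 / lam) ^ 2 + 1) / (1 / lam - 1) ^ 2 *
      (nbhdCount X x δ / N ^ 2) * ‖rVec lam μ X (q 0) (w 0) x‖ ^ 2 := by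
  set r := rVec lam μ X (q 0) (w 0) x with hr
  set k := kVec μ X (q 0) (w 0) x with hk
  have hlam : 0 < 1 / lam - 1 := by rw [sub_pos, lt_div_iff₀ hlam0]; linarith
  have hT0 : 0 ≤ ∑ j, k j := Finset.sum_nonneg fun j _ => kVec_nonneg ..
  have hrel := rVec_div_add_sum (μ := μ) (X := X) hlam0 hlam1 hna.measurable hsub.measurable x
  have hcol := sum_kMat_col_le_one (X := X) hsub hna.measurable hsn
  have hK0 : ∀ i j, 0 ≤ kMat μ X (q 0) (w 0) i j := fun _ _ => kVec_nonneg ..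
  -- The unknown mass `∑ k` bounds `r i` from above here and is eliminated through `h3` and `h2`,
  -- which bound it by `‖r‖`.
  have h1 : |r i| * (1 / lam - 1) ≤ (∑ j, k j) / N :=
    abs_mul_le_of_substochastic hlam0 hlam1 hK0 hcol hrel (div_nonneg hT0 hN0.le) (fun j => by
      rw [abs_of_nonneg (kVec_nonneg ..), le_div_iff₀ hN0, mul_comm]
      exact mul_kVec_le_sum hsub hna hsn hN x j) i
  have h2 : ∑ j, k j ^ 2 ≤ 2 * ((1 / lam) ^ 2 + 1) * ∑ j, r j ^ 2 :=
    sum_sq_le_of_substochastic hK0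
      (fun j => sum_kVec_le_one hna.measurable hsub.measurable (X j)) hcol hrel
  have h3 : (∑ j, k j) ^ 2 ≤ (nbhdCount X x δ : ℝ) * ∑ j, k j ^ 2 := sq_sum_kVec_le hna hδ x
  rw [← EuclideanSpace.real_norm_sq_eq] at h2
  have h4 : (|r i| * (1 / lam - 1)) ^ 2 ≤ ((∑ j, k j) / N) ^ 2 :=
    pow_le_pow_left₀ (by positivity) h1 2
  rw [mul_pow, sq_abs, ← le_div_iff₀ (by positivity)] at h4
  refine h4.trans ?_
  rw [div_pow]
  calc (∑ j, k j) ^ 2 / N ^ 2 / (1 / lam - 1) ^ 2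
      ≤ ((nbhdCount X x δ : ℝ) * (2 * ((1 / lam) ^ 2 + 1) * ‖r‖ ^ 2)) / N ^ 2 /
        (1 / lam - 1) ^ 2 := by
        gcongr
        exact h3.trans (mul_le_mul_of_nonneg_left h2 (Nat.cast_nonneg _))
    _ = _ := by ring

end Limit

/-- The number of points near `x` is negligible compared with the square of `n ^ (1 / (d + 2))`. -/
lemma tendsto_div_sq_rpow {d : ℕ} (hd : 1 ≤ d) {B δ : ℕ → ℝ} {ε₁ a : ℝ} (hε₁ : 0 < ε₁)
    (hδ_rate : δ =O[atTop] fun n : ℕ => (n : ℝ) ^ (-(1 / ((d : ℝ) + 2)) - ε₁))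
    (hB : B =O[atTop] fun n : ℕ => (n : ℝ) * δ n ^ d) :
    Tendsto (fun n : ℕ => B n / (a * (n : ℝ) ^ (1 / ((d : ℝ) + 2))) ^ 2) atTop (𝓝 0) := by
  have hdpos : (0 : ℝ) < d := by exact_mod_cast hd
  have h1 : B =O[atTop] fun n : ℕ => (n : ℝ) * ((n : ℝ) ^ (-(1 / ((d : ℝ) + 2)) - ε₁)) ^ d :=
    hB.trans ((isBigO_refl _ _).mul (hδ_rate.pow d))
  have h2 : (fun n : ℕ => B n / (a * (n : ℝ) ^ (1 / ((d : ℝ) + 2))) ^ 2) =O[atTop]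
      fun n : ℕ => (n : ℝ) ^ (-(d * ε₁)) := by
    have h3 := h1.mul (isBigO_refl
      (fun n : ℕ => ((a * (n : ℝ) ^ (1 / ((d : ℝ) + 2))) ^ 2)⁻¹) atTop)
    refine (h3.congr_left fun n => (div_eq_mul_inv _ _).symm).trans ?_
    refine IsBigO.of_bound ‖(a ^ 2)⁻¹‖ ?_
    filter_upwards [eventually_ge_atTop 1] with n hn
    have hn' : (0 : ℝ) < n := by exact_mod_cast hn
    rw [← norm_mul]
    refine le_of_eq (congrArg _ ?_)
    have e1 : ((n : ℝ) ^ (-(1 / ((d : ℝ) + 2)) - ε₁)) ^ d =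
        (n : ℝ) ^ ((-(1 / ((d : ℝ) + 2)) - ε₁) * d) := by
      rw [Real.rpow_mul hn'.le, Real.rpow_natCast]
    have e2 : ((n : ℝ) ^ (1 / ((d : ℝ) + 2))) ^ 2 = (n : ℝ) ^ (1 / ((d : ℝ) + 2) * 2) := by
      rw [Real.rpow_mul hn'.le]
      norm_cast
    have e3 : (n : ℝ) * (n : ℝ) ^ ((-(1 / ((d : ℝ) + 2)) - ε₁) * d) *
        ((n : ℝ) ^ (1 / ((d : ℝ) + 2) * 2))⁻¹ = (n : ℝ) ^ (-(d * ε₁)) := by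
      -- The critical exponents cancel, `1 - d / (d + 2) - 2 / (d + 2) = 0`, and only the gain `ε₁`
      -- in the diameter rate survives.
      have he : -(d * ε₁) =
          1 + (-(1 / ((d : ℝ) + 2)) - ε₁) * d + -(1 / ((d : ℝ) + 2) * 2) := by
        field_simp
        ring
      rw [he, Real.rpow_add hn', Real.rpow_add hn', Real.rpow_one, Real.rpow_neg hn'.le]
    rw [e1, mul_pow, e2, mul_inv, ← e3]
    ring
  refine h2.trans_tendsto ?_
  exact (tendsto_rpow_neg_atTop (by positivity)).comp tendsto_natCast_atTop_atTop

end

end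

end Boulevard

/-! ### Assembly: almost sure limit, negligible weights, central limit theorem -/

theorem theorem3
    -- dimension and learning rate
    {d : ℕ} (hd : 1 ≤ d) {lam : ℝ} (hlam0 : 0 < lam) (hlam1 : lam < 1)
    -- regression function, covariates, point of interest
    (f : EuclideanSpace ℝ (Fin d) → ℝ)
    (X : (n : ℕ) → Fin n → EuclideanSpace ℝ (Fin d))
    (hX : ∀ n i, X n i ∈ Boulevard.unitCube d)
    (x : EuclideanSpace ℝ (Fin d)) (hx : x ∈ Boulevard.unitCube d)
    -- error law: centred, sub-Gaussian, with variance `σ ^ 2`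
    (ν : Measure ℝ) [IsProbabilityMeasure ν] (σ c : ℝ≥0)
    (hν_subG : HasSubgaussianMGF id c ν) (hν_mean : ∫ e, e ∂ν = 0)
    (hν_var : ∫ e, e ^ 2 ∂ν = (σ : ℝ) ^ 2)
    -- for every sample size a probability space carrying the i.i.d. errors and the trees
    {Ω : ℕ → Type*} [∀ n, MeasurableSpace (Ω n)] (μ : (n : ℕ) → Measure (Ω n))
    [∀ n, IsProbabilityMeasure (μ n)]
    (ε : (n : ℕ) → Fin n → Ω n → ℝ) (hε_meas : ∀ n i, Measurable (ε n i))
    (hε_law : ∀ n i, (μ n).map (ε n i) = ν) (hε_indep : ∀ n, iIndepFun (ε n) (μ n))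
    (Y : (n : ℕ) → Ω n → Fin n → ℝ) (hY : ∀ n ω i, Y n ω i = f (X n i) + ε n i ω)
    (q : (n : ℕ) → ℕ → Ω n → Boulevard.TreeStructure d)
    (w : (n : ℕ) → ℕ → Ω n → Finset (Fin n))
    (Q : ℕ → Set (Boulevard.TreeStructure d))
    (s : ℕ → ℕ) (hs : ∀ n, 1 ≤ n → 1 ≤ s n ∧ s n ≤ n)
    (hsub : ∀ n, Boulevard.UniformSubsampling (μ n) (Y n) (q n) (w n) (s n))
    (hna : ∀ n, Boulevard.NonAdaptive (μ n) (Y n) (q n) (w n) (Q n))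
    (hsvi : ∀ n, Boulevard.StructureValueIsolation (μ n) (X n) (Y n) (q n) (w n))
    -- leaf diameters are bounded by `δ n`, with the required rate
    (δ : ℕ → ℝ) (hδ_pos : ∀ n, 0 < δ n)
    (hdiam : ∀ᶠ n in atTop, ∀ t ∈ Q n, ∀ A ∈ t.leaves, Metric.diam A ≤ δ n)
    (ε₁ : ℝ) (hε₁ : 0 < ε₁)
    (hδ_rate : δ =O[atTop] fun n : ℕ => (n : ℝ) ^ (-(1 / ((d : ℝ) + 2)) - ε₁))
    -- neighbourhood size and minimal leaf count
    (hB : (fun n => (Boulevard.nbhdCount (X n) x (δ n) : ℝ)) =Θ[atTop]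
      fun n : ℕ => (n : ℝ) * δ n ^ d)
    (hleaf : ∃ a : ℝ, 0 < a ∧ ∀ᶠ n : ℕ in atTop, ∀ t ∈ Q n, ∀ A ∈ t.leaves,
      a * (n : ℝ) ^ (1 / ((d : ℝ) + 2)) ≤ (Boulevard.leafCount (X n) A : ℝ)) :
    ∃ (C : ℝ) (fhat : (n : ℕ) → Ω n → ℝ), 0 < C ∧
      -- `fhat n` is the almost sure limit of the Boulevard predictions at `x`, for every
      -- truncation level `M` that is large compared with the responses
      (∀ n, ∀ᵐ ω ∂(μ n), ∀ M : ℝ, (∀ i, C * |Y n ω i| ≤ M) →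
        Tendsto (fun b => Boulevard.boulevard lam M (X n) (Y n ω) (fun j => q n j ω)
          (fun j => w n j ω) b x) atTop (𝓝 (fhat n ω))) ∧
      TendstoInDistribution
        (fun n ω =>
          (fhat n ω - ∑ i, Boulevard.rVec lam (μ n) (X n) (q n 0) (w n 0) x i * f (X n i)) /
            ‖Boulevard.rVec lam (μ n) (X n) (q n 0) (w n 0) x‖)
        atTop id μ (gaussianReal 0 (σ ^ 2)) := by
  have hYm : ∀ n, Measurable (Y n) := fun n => measurable_pi_iff.2 fun i => by
    simp only [hY]
    exact (hε_meas n i).const_add _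
  set r : (n : ℕ) → EuclideanSpace ℝ (Fin n) := fun n =>
    Boulevard.rVec lam (μ n) (X n) (q n 0) (w n 0) x with hr
  -- This constant keeps the fixed point inside the range where truncation is the identity.
  refine ⟨1 / (1 - lam), fun n ω => ∑ i, r n i * Y n ω i, one_div_pos.2 (by linarith),
    fun n => Boulevard.ae_tendsto_boulevard hlam0 hlam1 (hYm n) (hsub n) (hna n) (hsvi n)
      (fun hn => (hs n hn).2) x, ?_⟩
  obtain ⟨a, ha, hleaf⟩ := hleaf
  have hgood : ∀ᶠ n : ℕ in atTop, r n ≠ 0 ∧ ∀ i, r n i ^ 2 ≤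
      2 * ((1 / lam) ^ 2 + 1) / (1 / lam - 1) ^ 2 * (Boulevard.nbhdCount (X n) x (δ n) /
        (a * (n : ℝ) ^ (1 / ((d : ℝ) + 2))) ^ 2) * ‖r n‖ ^ 2 := by
    filter_upwards [hleaf, hdiam, eventually_ge_atTop 1] with n h1 h2 hn
    have hn' : (0 : ℝ) < n := by exact_mod_cast hn
    have hN : 0 < a * (n : ℝ) ^ (1 / ((d : ℝ) + 2)) := by positivity
    refine ⟨Boulevard.rVec_ne_zero hlam0 hlam1 (hsub n) (hna n) (hs n hn).1 (hs n hn).2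
      (fun t ht A hA => ?_) hx, Boulevard.sq_rVec_le hlam0 hlam1 (hsub n) (hna n) (hs n hn).2
        hN h1 h2 x⟩
    exact_mod_cast hN.trans_le (h1 t ht A hA)
  have hrate : Tendsto (fun n : ℕ => 2 * ((1 / lam) ^ 2 + 1) / (1 / lam - 1) ^ 2 *
      (Boulevard.nbhdCount (X n) x (δ n) / (a * (n : ℝ) ^ (1 / ((d : ℝ) + 2))) ^ 2))
      atTop (𝓝 0) := by
    have h := (Boulevard.tendsto_div_sq_rpow (a := a) hd hε₁ hδ_rate hB.1).const_mul
      (2 * ((1 / lam) ^ 2 + 1) / (1 / lam - 1) ^ 2)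
    rwa [mul_zero] at h
  have hclt := Boulevard.tendstoInDistribution_weightedSum (σ := σ) (hν_subG.memLp 2) hν_mean
    hν_var μ ε hε_meas hε_law hε_indep (fun n i => r n i / ‖r n‖)
    (by
      filter_upwards [hgood] with n hn
      have h0 : ‖r n‖ ^ 2 ≠ 0 := pow_ne_zero 2 (norm_ne_zero_iff.2 hn.1)
      simp only [div_pow]
      rw [← Finset.sum_div, ← EuclideanSpace.real_norm_sq_eq, div_self h0])
    (by
      intro η hη
      filter_upwards [hgood, hrate.eventually_lt_const (pow_pos hη 2)] with n hn hlt i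
      have h0 : 0 < ‖r n‖ := norm_pos_iff.2 hn.1
      refine abs_le_of_sq_le_sq ?_ hη.le
      rw [div_pow, div_le_iff₀ (by positivity)]
      exact (hn.2 i).trans (mul_le_mul_of_nonneg_right hlt.le (by positivity)))
  convert hclt using 3 with n ω
  -- The signal part `rᵀ f` cancels exactly, which leaves the normalised weighted sum of the errors.
  change (∑ i, r n i * Y n ω i - ∑ i, r n i * f (X n i)) / ‖r n‖ = _
  simp only [hY, mul_add, Finset.sum_add_distrib, add_sub_cancel_left]
  rw [Finset.sum_div]
  exact Finset.sum_congr rfl fun i _ => by ring
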